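/- **Notation.** Fix $T>0$, $d,n\in\mathbb N$, $1\le p<p'<\infty$. All $\mathbb R^m$ carry the Euclidean norm, $C_T(\mathbb R^m)=C([0,T],\mathbb R^m)$ carries the supremum norm. For a separable normed space $E$, $\mathcal P_q(E)$ is the set of Borel probability measures with finite $q$-th moment, $$\mathcal W_{E,q}(\mu,\nu)=\Big(\inf_{m}\iint \|x-y\|^q\,m(dx,dy)\Big)^{1/q},$$ the infimum being over all couplings $m$ of $\mu$ and $\nu$, and $L^N(y)=\frac1N\sum_{i=1}^N\delta_{y^i}$ for $y=(y^1,\dots,y^N)\in E^N$. $\mathcal L(Y)$ is the law of $Y$. **Drift.** Let $b:[0,T]\times\mathbb R^{d+n}\times\mathcal P_p(\mathbb R^{d+n})\to\mathbb R^d$ be Borel measurable and suppose there is a constant $K_b$ such that for all $t\in[0,T]$, $x,x'\in\mathbb R^{d+n}$, $\mu,\mu'\in\mathcal P_p(\mathbb R^{d+n})$, $$|b(t,x,\mu)-b(t,x',\mu')|^p\le K_b\big(|x-x'|^p+\mathcal W_{\mathbb R^{d+n},p}(\mu,\mu')^p\big).$$ **Inputs.** On a probability space $(\Omega,\mathcal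 A,\mathbb P)$ let $(\zeta^i)_{i\ge1}\subset L^{p'}(\Omega,\mathbb R^d)$ and $(W^i)_{i\ge1}\subset L^{p'}(\Omega,C_T(\mathbb R^d))$ be two families of i.i.d. random variables, independent of each other. For each $N\ge1$ let $R^{(N)}=(R^{i,N})_{1\le i\le N}\subset L^{p'}(\Omega,C_T(\mathbb R^n))$ be a family of independent (not necessarily identically distributed) random variables, independent of $((\zeta^i)_i,(W^i)_i)$. Let $\bar\zeta,\bar W,\bar R$ be independent random variables (possibly on another probability space) with values in $\mathbb R^d$, $C_T(\mathbb R^d)$, $C_T(\mathbb R^n)$, such that $\bar\zeta$ is distributed as $\zeta^1$ and $\bar W$ as $W^1$; put $\lambda=\mathcal L(\bar R)$. **Solutions.** For each $N\ge1$ let $X^{(N)}=(X^{i,N})_{1\le i\le N}$ be a random variable with values in $C_T(\mathbb R^d)^N$ which $\mathbb P$-a.s. solves $$X^{i,N}_t=\zeta^i+\int_0^t b\big(s,(X^{i,N}_s,R^{i,N}_s),L^N(X^{(N)}_s,R^{(N)}_s)\big)\,ds+W^i_t,\qquad t\in[0,T],\ 1\le i\le N,$$ and let $\bar X$ be a random variable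 with values in $C_T(\mathbb R^d)$, with $\mathcal L(\bar X_s,\bar R_s)\in\mathcal P_p(\mathbb R^{d+n})$ for all $s$, which a.s. solves the McKean–Vlasov equation $$\bar X_t=\bar\zeta+\int_0^t b\big(s,(\bar X_s,\bar R_s),\mathcal L(\bar X_s,\bar R_s)\big)\,ds+\bar W_t,\qquad t\in[0,T];$$ in both equations the integrands are required to be integrable on $[0,T]$. **Claim.** If, $\mathbb P$-almost surely, $\mathcal W_{C_T(\mathbb R^n),p'}(L^N(R^{(N)}),\lambda)\to0$ as $N\to\infty$, then, $\mathbb P$-almost surely, $$\mathcal W_{C_T(\mathbb R^{d+n}),p}\big(L^N(X^{(N)},R^{(N)}),\mathcal L(\bar X,\bar R)\big)\to0\qquad\text{as }N\to\infty.$$ -/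

import Mathlib

open MeasureTheory ProbabilityTheory Filter Topology
open scoped ENNReal NNReal

/-- `ℝ^d` with the Euclidean norm. -/
abbrev Euc (d : ℕ) : Type := EuclideanSpace ℝ (Fin d)

/-- `ℝ^{d+n}`, written as the orthogonal sum `ℝ^d ⊕ ℝ^n`; its norm is
`|(x, r)| = √(|x|² + |r|²)`. -/
abbrev EucPair (d n : ℕ) : Type := WithLp 2 (Euc d × Euc n)

/-- The path space `C_T(V) = C([0,T], V)`; for a normed space `V` it carries the supremum norm. -/
abbrev PathSpace (T : ℝ) (V : Type*) [TopologicalSpace V] : Type _ := C(Set.Icc (0 : ℝ) T, V)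

/-- The path space carries its Borel σ-algebra. -/
instance PathSpace.instMeasurableSpace (T : ℝ) (V : Type*) [TopologicalSpace V] :
    MeasurableSpace (PathSpace T V) :=
  borel _

instance PathSpace.instBorelSpace (T : ℝ) (V : Type*) [TopologicalSpace V] :
    BorelSpace (PathSpace T V) :=
  ⟨rfl⟩

/-- Lebesgue measure on `[0,T]`. -/
noncomputable def lebesgueIcc (T : ℝ) : Measure (Set.Icc (0 : ℝ) T) :=
  (volume : Measure ℝ).comap Subtype.val

/-- The path `t ↦ (x_t, r_t)` in `ℝ^{d+n}`. -/
def pairPath {T : ℝ} {d n : ℕ} (x : PathSpace T (Euc d)) (r : PathSpace T (Euc n)) :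
    PathSpace T (EucPair d n) :=
  ⟨fun t => WithLp.toLp 2 (x t, r t), by fun_prop⟩

/-- The `p`-Wasserstein distance, for the metric of `E`,
`W_p(μ, ν) = (inf_m ∫∫ d(x, y)^p m(dx, dy))^{1/p}`, where `m` runs over the measures on `E × E`
with first marginal `μ` and second marginal `ν`. -/
noncomputable def wasserstein {E : Type*} [PseudoEMetricSpace E] [MeasurableSpace E] (p : ℝ)
    (μ ν : Measure E) : ℝ≥0∞ :=
  (⨅ (m : Measure (E × E)) (_ : m.map Prod.fst = μ ∧ m.map Prod.snd = ν),
    ∫⁻ z, edist z.1 z.2 ^ p ∂m) ^ (1 / p)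

/-- The space `𝒫_p(E)` of the probability measures on `E` with finite `p`-th moment. -/
structure FiniteMomentMeasure (p : ℝ) (E : Type*) [NormedAddCommGroup E] [MeasurableSpace E] where
  toMeasure : Measure E
  isProbabilityMeasure : IsProbabilityMeasure toMeasure
  moment_lt_top : ∫⁻ x, ‖x‖ₑ ^ p ∂toMeasure < ∞

/-- The topology of the `p`-Wasserstein distance on `𝒫_p(E)`: a set is open if around each of its
points it contains a ball of positive radius. -/
instance FiniteMomentMeasure.instTopologicalSpace (p : ℝ) (E : Type*) [NormedAddCommGroup E]
    [MeasurableSpace E] : TopologicalSpace (FiniteMomentMeasure p E) where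
  IsOpen U := ∀ μ ∈ U, ∃ ε : ℝ≥0∞, 0 < ε ∧
    ∀ ν : FiniteMomentMeasure p E, wasserstein p μ.toMeasure ν.toMeasure < ε → ν ∈ U
  isOpen_univ := fun _ _ => ⟨1, one_pos, fun _ _ => Set.mem_univ _⟩
  isOpen_inter := by
    rintro U V hU hV μ ⟨hμU, hμV⟩
    obtain ⟨ε, hε, hεU⟩ := hU μ hμU
    obtain ⟨δ, hδ, hδV⟩ := hV μ hμV
    exact ⟨min ε δ, lt_min hε hδ, fun ν hν =>
      ⟨hεU ν (hν.trans_le (min_le_left _ _)), hδV ν (hν.trans_le (min_le_right _ _))⟩⟩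
  isOpen_sUnion := by
    rintro S hS μ ⟨U, hUS, hμU⟩
    obtain ⟨ε, hε, hεU⟩ := hS U hUS μ hμU
    exact ⟨ε, hε, fun ν hν => ⟨U, hUS, hεU ν hν⟩⟩

/-- `𝒫_p(E)` carries the Borel σ-algebra of the `p`-Wasserstein distance. -/
instance FiniteMomentMeasure.instMeasurableSpace (p : ℝ) (E : Type*) [NormedAddCommGroup E]
    [MeasurableSpace E] : MeasurableSpace (FiniteMomentMeasure p E) :=
  borel _

instance FiniteMomentMeasure.instBorelSpace (p : ℝ) (E : Type*) [NormedAddCommGroup E]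
    [MeasurableSpace E] : BorelSpace (FiniteMomentMeasure p E) :=
  ⟨rfl⟩

/-- The empirical measure `L^N(y) = (1/N) ∑_{i=1}^N δ_{y^i}` (only meaningful for `N ≥ 1`). -/
noncomputable def empiricalMeasure {E : Type*} [MeasurableSpace E] {N : ℕ} (y : Fin N → E) :
    Measure E :=
  (N : ℝ≥0∞)⁻¹ • ∑ i, Measure.dirac (y i)

/-- A drift `b : [0,T] × ℝ^{d+n} × 𝒫_p(ℝ^{d+n}) → ℝ^d`. -/
abbrev Drift (T p : ℝ) (d n : ℕ) : Type :=
  Set.Icc (0 : ℝ) T → EucPair d n → FiniteMomentMeasure p (EucPair d n) → Euc d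

/-- For a given flow of measures `μ_t` and given inputs `x₀`, `w`, `r`, the path `x` satisfies
`x_t = x₀ + ∫_0^t b(s, (x_s, r_s), μ_s) ds + w_t` for all `t ∈ [0,T]`, where the integrand is
integrable on `[0,T]`. (In the type `[0,T]` the interval `Set.Iic t` is `[0,t]`.) -/
def SolvesIntegralEquation {T p : ℝ} {d n : ℕ} (b : Drift T p d n)
    (μ : Set.Icc (0 : ℝ) T → FiniteMomentMeasure p (EucPair d n))
    (x₀ : Euc d) (w : PathSpace T (Euc d)) (r : PathSpace T (Euc n))
    (x : PathSpace T (Euc d)) : Prop :=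
  Integrable (fun s => b s (pairPath x r s) (μ s)) (lebesgueIcc T) ∧
    ∀ t, x t = x₀ + (∫ s in Set.Iic t, b s (pairPath x r s) (μ s) ∂(lebesgueIcc T)) + w t

/-- The paths `x^1, …, x^N` solve the system of `N` interacting particles
`dx^i_t = b(t, (x^i_t, r^i_t), L^N((x_t, r_t))) dt + dw^i_t` with initial values `x₀^i`. -/
def SolvesParticleSystem {T p : ℝ} {d n N : ℕ} (b : Drift T p d n)
    (x₀ : Fin N → Euc d) (w : Fin N → PathSpace T (Euc d)) (r : Fin N → PathSpace T (Euc n))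
    (x : Fin N → PathSpace T (Euc d)) : Prop :=
  ∃ μ : Set.Icc (0 : ℝ) T → FiniteMomentMeasure p (EucPair d n),
    (∀ t, (μ t).toMeasure = empiricalMeasure fun i => pairPath (x i) (r i) t) ∧
    ∀ i, SolvesIntegralEquation b μ (x₀ i) (w i) (r i) (x i)

/-- The random path `X` on the probability space `(Ω, P)` solves the McKean–Vlasov equation
`dX_t = b(t, (X_t, R_t), Law(X_t, R_t)) dt + dW_t` with initial value `ζ`: the equation holds in
integrated form along almost every path. In particular `Law(X_t, R_t)` lies in `𝒫_p`. -/
def SolvesMcKeanVlasov {T p : ℝ} {d n : ℕ} (b : Drift T p d n)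
    {Ω : Type*} [MeasurableSpace Ω] (P : Measure Ω)
    (ζ : Ω → Euc d) (W : Ω → PathSpace T (Euc d)) (R : Ω → PathSpace T (Euc n))
    (X : Ω → PathSpace T (Euc d)) : Prop :=
  Measurable X ∧
  ∃ μ : Set.Icc (0 : ℝ) T → FiniteMomentMeasure p (EucPair d n),
    (∀ t, (μ t).toMeasure = P.map fun ω => pairPath (X ω) (R ω) t) ∧
    ∀ᵐ ω ∂P, SolvesIntegralEquation b μ (ζ ω) (W ω) (R ω) (X ω)

/-! For a fixed outcome ω the particle system is itself a McKean–Vlasov equation: on the index set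
`Fin N` with its uniform law, the random path i ↦ X^{i,N}(ω) solves it with inputs (ζ^i, W^i,
R^{i,N})(ω), and the law of the solution is the empirical measure. The theorem thus reduces to
stability of McKean–Vlasov equations in their inputs: if `Fin N` and `Ω'` are coupled so that the
two input triples are close in L^p, the laws of the solutions are close. Gronwall is used twice for
this, path by path with the measure flows as data (`exists_edist_le_of_solvesIntegralEquation`),
then for the distance between the flows (`exists_wasserstein_map_pairPath_le`).

The couplings come from `ae_eventually_exists_coupling`. Probability measures that give nearly equal
masses to the cells of a fine partition can be coupled inside the cells up to a small mass, and
bounded p'-moments make the exceptional part negligible in L^p because p < p'. The empirical masses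
of product cells converge almost surely: Hoeffding and Borel–Cantelli replace the ζ- and
W-indicators by their probabilities, with the remaining indicators as independent weights, and the
frequencies of the R-cells converge by hypothesis when the cell boundaries are null. -/

/-! ### Gronwall's inequality without measurability -/

theorem lebesgueIcc_univ (T : ℝ) : lebesgueIcc T Set.univ = ENNReal.ofReal T := by
  have h := setLIntegral_subtype (μ := volume) (measurableSet_Icc (a := (0 : ℝ)) (b := T))
    Set.univ (fun _ => 1)
  rw [lebesgueIcc]
  simpa only [lintegral_const, one_mul, Measure.restrict_univ, Measure.restrict_apply_univ,
    Set.image_univ, Subtype.range_coe, Real.volume_Icc, sub_zero] using h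

theorem lintegral_Iic_exp_le {T C : ℝ} (hC : 0 < C) (t : Set.Icc (0 : ℝ) T) :
    ∫⁻ s in Set.Iic t, ENNReal.ofReal (Real.exp (C * s)) ∂(lebesgueIcc T) ≤
      ENNReal.ofReal (Real.exp (C * t) / C) := by
  have h1 := setLIntegral_subtype (μ := volume) (measurableSet_Icc (a := (0 : ℝ)) (b := T))
    (Set.Iic t) (fun x => ENNReal.ofReal (Real.exp (C * x)))
  rw [lebesgueIcc, h1, ← integral_exp_mul_Iic hC,
    ofReal_integral_eq_lintegral_ofReal (integrableOn_exp_mul_Iic hC _)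
      (ae_of_all _ fun x => (Real.exp_pos _).le)]
  refine lintegral_mono_set ?_
  rintro _ ⟨s, hs, rfl⟩
  exact hs

/-- Gronwall's inequality for a bounded function that need not be measurable. -/
theorem le_of_le_add_lintegral {T C : ℝ} (hC : 0 < C) {A M : ℝ≥0∞} (hM : M ≠ ∞)
    {u : Set.Icc (0 : ℝ) T → ℝ≥0∞} (hu : ∀ t, u t ≤ M)
    (h : ∀ t, u t ≤ A + ENNReal.ofReal C * ∫⁻ s in Set.Iic t, u s ∂(lebesgueIcc T))
    (t : Set.Icc (0 : ℝ) T) :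
    u t ≤ ENNReal.ofReal (2 * Real.exp (2 * C * T)) * A := by
  -- The rate 2C makes the integral operator a contraction with factor 1/2 for the weighted supremum
  -- `q` of u/e. The resulting bound q ≤ A + q/2 can be absorbed because q ≤ M is finite. Only
  -- monotonicity of the integral and extraction of finite constants are needed, so u may be
  -- nonmeasurable.
  set e : Set.Icc (0 : ℝ) T → ℝ≥0∞ := fun t => ENNReal.ofReal (Real.exp (2 * C * t)) with he
  have hepos : ∀ t, e t ≠ 0 := fun t => by simp [he, Real.exp_pos]
  have hetop : ∀ t, e t ≠ ∞ := fun t => ENNReal.ofReal_ne_top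
  have hone : ∀ t, 1 ≤ e t := fun t => by
    rw [he, ← ENNReal.ofReal_one]
    refine ENNReal.ofReal_le_ofReal (Real.one_le_exp ?_)
    have := t.2.1
    positivity
  set q : ℝ≥0∞ := ⨆ t, (e t)⁻¹ * u t with hq
  have hqM : q ≤ M := iSup_le fun t => by
    calc (e t)⁻¹ * u t ≤ 1 * M := by
          gcongr
          · exact ENNReal.inv_le_one.2 (hone t)
          · exact hu t
      _ = M := one_mul _
  have hue : ∀ t, u t ≤ e t * q := fun t => by
    have : (e t)⁻¹ * u t ≤ q := le_iSup (fun t => (e t)⁻¹ * u t) t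
    calc u t = e t * ((e t)⁻¹ * u t) := by
          rw [← mul_assoc, ENNReal.mul_inv_cancel (hepos t) (hetop t), one_mul]
      _ ≤ e t * q := by gcongr
  have hint : ∀ t, ENNReal.ofReal C * ∫⁻ s in Set.Iic t, u s ∂(lebesgueIcc T) ≤
      e t * (q / 2) := fun t => by
    calc ENNReal.ofReal C * ∫⁻ s in Set.Iic t, u s ∂(lebesgueIcc T)
        ≤ ENNReal.ofReal C * ∫⁻ s in Set.Iic t, e s * q ∂(lebesgueIcc T) := by
          gcongr with s
          exact hue s
      _ = ENNReal.ofReal C * ((∫⁻ s in Set.Iic t, e s ∂(lebesgueIcc T)) * q) := by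
          rw [lintegral_mul_const' _ _ (hqM.trans_lt hM.lt_top).ne]
      _ ≤ ENNReal.ofReal C * (ENNReal.ofReal (Real.exp (2 * C * t) / (2 * C)) * q) := by
          gcongr
          exact lintegral_Iic_exp_le (by positivity) t
      _ = e t * (q / 2) := by
          rw [← mul_assoc, ← ENNReal.ofReal_mul hC.le, he]
          have : C * (Real.exp (2 * C * t) / (2 * C)) = Real.exp (2 * C * t) / 2 := by
            field_simp
          rw [this, ENNReal.ofReal_div_of_pos two_pos, ENNReal.ofReal_ofNat, div_eq_mul_inv,
            div_eq_mul_inv]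
          ring
  have hq2 : q ≤ A + q / 2 := iSup_le fun t => by
    calc (e t)⁻¹ * u t ≤ (e t)⁻¹ * (A + e t * (q / 2)) := by
          gcongr
          exact (h t).trans (add_le_add le_rfl (hint t))
      _ = (e t)⁻¹ * A + q / 2 := by
          rw [mul_add, ← mul_assoc, ENNReal.inv_mul_cancel (hepos t) (hetop t), one_mul]
      _ ≤ 1 * A + q / 2 := by
          gcongr
          exact ENNReal.inv_le_one.2 (hone t)
      _ = A + q / 2 := by rw [one_mul]
  have hqtop : q ≠ ∞ := (hqM.trans_lt hM.lt_top).ne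
  have hqA : q / 2 ≤ A := by
    have h2 : q / 2 + q / 2 ≤ A + q / 2 := by rwa [ENNReal.add_halves]
    exact (ENNReal.add_le_add_iff_right (ENNReal.div_ne_top hqtop two_ne_zero)).1 h2
  have hq3 : q ≤ 2 * A := by
    calc q = 2 * (q / 2) := by rw [two_mul, ENNReal.add_halves]
      _ ≤ 2 * A := by gcongr
  calc u t ≤ e t * q := hue t
    _ ≤ ENNReal.ofReal (Real.exp (2 * C * T)) * (2 * A) := by
        gcongr
        refine ENNReal.ofReal_le_ofReal (Real.exp_le_exp.2 ?_)
        have := t.2.2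
        gcongr
    _ = ENNReal.ofReal (2 * Real.exp (2 * C * T)) * A := by
        rw [ENNReal.ofReal_mul two_pos.le, ENNReal.ofReal_ofNat]
        ring

/-- Gronwall's inequality with a nondecreasing additive term. -/
theorem le_of_le_monotone_add_lintegral {T C : ℝ} (hC : 0 < C) {M : ℝ≥0∞} (hM : M ≠ ∞)
    {A u : Set.Icc (0 : ℝ) T → ℝ≥0∞} (hA : Monotone A) (hu : ∀ t, u t ≤ M)
    (h : ∀ t, u t ≤ A t + ENNReal.ofReal C * ∫⁻ s in Set.Iic t, u s ∂(lebesgueIcc T))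
    (t : Set.Icc (0 : ℝ) T) :
    u t ≤ ENNReal.ofReal (2 * Real.exp (2 * C * T)) * A t := by
  -- Freeze the additive term at its value at t and set u to zero after t; the truncated function
  -- satisfies the inequality with a constant term.
  have key := le_of_le_add_lintegral (T := T) (A := A t) hC hM
    (u := fun s => if s ≤ t then u s else 0)
    (fun s => by split_ifs; exacts [hu s, zero_le]) (fun s => by
      split_ifs with hs
      · refine (h s).trans (add_le_add (hA hs) (mul_le_mul_right (le_of_eq ?_) _))
        refine setLIntegral_congr_fun measurableSet_Iic fun r hr => ?_
        simp [le_trans (Set.mem_Iic.1 hr) hs]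
      · exact zero_le) t
  simpa using key

/-! ### Wasserstein distances and couplings -/

/-- The image of `m` under s ↦ (f s, g s) is an admissible coupling. `lintegral_map_le` needs no
measurability of the distance. -/
theorem wasserstein_le_of_coupling {S E : Type*} [MeasurableSpace S] [PseudoEMetricSpace E]
    [MeasurableSpace E] {p : ℝ} (hp : 0 ≤ p) {m : Measure S} {μ ν : Measure E} {f g : S → E}
    (hf : Measurable f) (hg : Measurable g) (hμ : m.map f = μ) (hν : m.map g = ν) :
    wasserstein p μ ν ≤ (∫⁻ s, edist (f s) (g s) ^ p ∂m) ^ (1 / p) := by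
  refine ENNReal.rpow_le_rpow ?_ (by positivity)
  refine (iInf₂_le (m.map fun s => (f s, g s)) ⟨?_, ?_⟩).trans (lintegral_map_le _ _)
  · rw [Measure.map_map measurable_fst (hf.prodMk hg)]
    exact hμ
  · rw [Measure.map_map measurable_snd (hf.prodMk hg)]
    exact hν

theorem wasserstein_self {E : Type*} [PseudoEMetricSpace E] [MeasurableSpace E] {p : ℝ}
    (hp : 0 < p) (μ : Measure E) : wasserstein p μ μ = 0 := by
  have h := wasserstein_le_of_coupling (m := μ) hp.le measurable_id measurable_id
    Measure.map_id Measure.map_id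
  simpa [hp, hp.not_gt] using h

theorem edist_pair_le {d n : ℕ} (x y : Euc d) (r q : Euc n) :
    edist (WithLp.toLp 2 (x, r) : EucPair d n) (WithLp.toLp 2 (y, q)) ≤ edist x y + edist r q := by
  rw [WithLp.prod_edist_eq_add (by norm_num)]
  exact ENNReal.rpow_add_rpow_le_add _ _ (by norm_num)

theorem edist_apply_le_edist {T : ℝ} {V : Type*} [PseudoMetricSpace V] (x y : PathSpace T V)
    (t : Set.Icc (0 : ℝ) T) : edist (x t) (y t) ≤ edist x y := by
  rw [ContinuousMap.edist_eq_iSup]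
  exact le_iSup (fun t => edist (x t) (y t)) t

theorem edist_pairPath_le {T : ℝ} {d n : ℕ} (x y : PathSpace T (Euc d))
    (r q : PathSpace T (Euc n)) :
    edist (pairPath x r) (pairPath y q) ≤ edist x y + edist r q := by
  rw [ContinuousMap.edist_eq_iSup]
  exact iSup_le fun t => (edist_pair_le _ _ _ _).trans
    (add_le_add (edist_apply_le_edist _ _ t) (edist_apply_le_edist _ _ t))

/-! ### Pathwise stability -/

section Stability

variable {T p : ℝ} {d n : ℕ}

/-- Taking p-th roots gives a linear bound suited to Gronwall, since (a^p + w^p)^{1/p} ≤ a + w. The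
extra 1 keeps the constant at least 1. -/
theorem enorm_sub_le_of_lipschitz (hp : 1 ≤ p) {b : Drift T p d n} {K : ℝ≥0}
    (hb_lip : ∀ (t : Set.Icc (0 : ℝ) T) (x x' : EucPair d n)
      (μ μ' : FiniteMomentMeasure p (EucPair d n)),
      ‖b t x μ - b t x' μ'‖ₑ ^ p ≤
        K * (‖x - x'‖ₑ ^ p + wasserstein p μ.toMeasure μ'.toMeasure ^ p))
    (t : Set.Icc (0 : ℝ) T) (x x' : EucPair d n) (μ μ' : FiniteMomentMeasure p (EucPair d n)) :
    ‖b t x μ - b t x' μ'‖ₑ ≤ ENNReal.ofReal ((K : ℝ) ^ (1 / p) + 1) *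
      (edist x x' + wasserstein p μ.toMeasure μ'.toMeasure) := by
  have hp0 : 0 < p := by linarith
  set a := edist x x'
  set w := wasserstein p μ.toMeasure μ'.toMeasure
  have h1 := ENNReal.rpow_le_rpow (hb_lip t x x' μ μ') (by positivity : 0 ≤ 1 / p)
  rw [← ENNReal.rpow_mul, mul_one_div_cancel hp0.ne', ENNReal.rpow_one,
    ENNReal.mul_rpow_of_nonneg _ _ (by positivity)] at h1
  rw [show a = ‖x - x'‖ₑ from edist_eq_enorm_sub _ _]
  refine h1.trans (mul_le_mul' ?_ (ENNReal.rpow_add_rpow_le_add _ _ hp))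
  rw [ENNReal.ofReal_add (by positivity) zero_le_one, ← ENNReal.ofReal_rpow_of_nonneg
    (by positivity) (by positivity), ENNReal.ofReal_coe_nnreal]
  exact le_self_add

/-- Once the measure flows are regarded as data, the equation is an integral equation for single
paths with additive noise, so Gronwall applies with a constant independent of paths and flows. The
Wasserstein integral stops at t so that a second Gronwall argument, for the flows, can use it. -/
theorem exists_edist_le_of_solvesIntegralEquation (hT : 0 < T) (hp : 1 ≤ p) {b : Drift T p d n}
    {K : ℝ≥0} (hb_lip : ∀ (t : Set.Icc (0 : ℝ) T) (x x' : EucPair d n)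
      (μ μ' : FiniteMomentMeasure p (EucPair d n)),
      ‖b t x μ - b t x' μ'‖ₑ ^ p ≤
        K * (‖x - x'‖ₑ ^ p + wasserstein p μ.toMeasure μ'.toMeasure ^ p)) :
    ∃ C : ℝ, 0 < C ∧ ∀ (μ ν : Set.Icc (0 : ℝ) T → FiniteMomentMeasure p (EucPair d n))
      (x₀ y₀ : Euc d) (w v : PathSpace T (Euc d)) (r q : PathSpace T (Euc n))
      (x y : PathSpace T (Euc d)), SolvesIntegralEquation b μ x₀ w r x →
      SolvesIntegralEquation b ν y₀ v q y → ∀ t, edist (x t) (y t) ≤ ENNReal.ofReal C *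
        ((edist x₀ y₀ + edist w v + edist r q) +
          ∫⁻ s in Set.Iic t, wasserstein p (μ s).toMeasure (ν s).toMeasure ∂(lebesgueIcc T)) := by
  set L : ℝ := (K : ℝ) ^ (1 / p) + 1 with hL
  have hLpos : 0 < L := by positivity
  have hL1 : 1 ≤ L := by
    have : 0 ≤ (K : ℝ) ^ (1 / p) := by positivity
    linarith
  refine ⟨2 * Real.exp (2 * L * T) * (L * (1 + T)), by positivity, ?_⟩
  intro μ ν x₀ y₀ w v r q x y hx hy t
  set J : Set.Icc (0 : ℝ) T → ℝ≥0∞ := fun t =>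
    ∫⁻ s in Set.Iic t, wasserstein p (μ s).toMeasure (ν s).toMeasure ∂(lebesgueIcc T) with hJ
  set D : ℝ≥0∞ := edist x₀ y₀ + edist w v + edist r q with hD
  have hJm : Monotone J := fun s t hst => lintegral_mono_set (Set.Iic_subset_Iic.2 hst)
  have hdrift : ∀ t, ‖(∫ s in Set.Iic t, b s (pairPath x r s) (μ s) ∂(lebesgueIcc T)) -
      ∫ s in Set.Iic t, b s (pairPath y q s) (ν s) ∂(lebesgueIcc T)‖ₑ ≤
      ENNReal.ofReal L * ((∫⁻ s in Set.Iic t, edist (x s) (y s) ∂(lebesgueIcc T)) +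
        ENNReal.ofReal T * edist r q + J t) := fun t => by
    rw [← integral_sub hx.1.integrableOn hy.1.integrableOn]
    refine (enorm_integral_le_lintegral_enorm _).trans ?_
    calc ∫⁻ s in Set.Iic t, ‖b s (pairPath x r s) (μ s) - b s (pairPath y q s) (ν s)‖ₑ
          ∂(lebesgueIcc T)
        ≤ ∫⁻ s in Set.Iic t, ENNReal.ofReal L * ((edist (x s) (y s) + edist r q) +
          wasserstein p (μ s).toMeasure (ν s).toMeasure) ∂(lebesgueIcc T) := by
          refine lintegral_mono fun s => (enorm_sub_le_of_lipschitz hp hb_lip _ _ _ _ _).trans ?_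
          gcongr
          exact (edist_pair_le _ _ _ _).trans (add_le_add le_rfl (edist_apply_le_edist _ _ s))
      _ = ENNReal.ofReal L * (((∫⁻ s in Set.Iic t, edist (x s) (y s) ∂(lebesgueIcc T)) +
          (lebesgueIcc T (Set.Iic t)) * edist r q) + J t) := by
          -- Measurability of this summand alone allows the integral to be split; none is known for
          -- the Wasserstein term.
          have hm : Measurable fun s => edist (x s) (y s) :=
            (x.continuous.edist y.continuous).measurable
          rw [lintegral_const_mul' _ _ ENNReal.ofReal_ne_top, lintegral_add_left (by fun_prop),
            lintegral_add_left hm, lintegral_const]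
          simp [mul_comm, hJ]
      _ ≤ _ := by
          gcongr
          exact (measure_mono (Set.subset_univ _)).trans (lebesgueIcc_univ T).le
  have hgron := le_of_le_monotone_add_lintegral (T := T) hLpos (edist_ne_top x y)
    (A := fun t => ENNReal.ofReal (L * (1 + T)) * (D + J t))
    (fun s t hst => by dsimp only; gcongr; exact hJm hst)
    (edist_apply_le_edist x y) (fun t => by
      calc edist (x t) (y t) ≤ edist x₀ y₀ + ‖(∫ s in Set.Iic t, b s (pairPath x r s) (μ s)
            ∂(lebesgueIcc T)) - ∫ s in Set.Iic t, b s (pairPath y q s) (ν s) ∂(lebesgueIcc T)‖ₑ +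
            edist w v := by
            rw [hx.2 t, hy.2 t, ← edist_eq_enorm_sub]
            refine (edist_add_add_le _ _ _ _).trans ?_
            gcongr
            · exact edist_add_add_le _ _ _ _
            · exact edist_apply_le_edist w v t
        _ ≤ edist x₀ y₀ + ENNReal.ofReal L * ((∫⁻ s in Set.Iic t, edist (x s) (y s)
            ∂(lebesgueIcc T)) + ENNReal.ofReal T * edist r q + J t) + edist w v := by
            gcongr
            exact hdrift t
        _ = (edist x₀ y₀ + edist w v) + ENNReal.ofReal L * ENNReal.ofReal T * edist r q +
            ENNReal.ofReal L * J t +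
            ENNReal.ofReal L * ∫⁻ s in Set.Iic t, edist (x s) (y s) ∂(lebesgueIcc T) := by ring
        _ ≤ ENNReal.ofReal (L * (1 + T)) * (edist x₀ y₀ + edist w v) +
            ENNReal.ofReal (L * (1 + T)) * edist r q + ENNReal.ofReal (L * (1 + T)) * J t +
            ENNReal.ofReal L * ∫⁻ s in Set.Iic t, edist (x s) (y s) ∂(lebesgueIcc T) := by
            have h1 : (1 : ℝ≥0∞) ≤ ENNReal.ofReal (L * (1 + T)) := by
              rw [← ENNReal.ofReal_one]
              exact ENNReal.ofReal_le_ofReal (by nlinarith)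
            have h2 : ENNReal.ofReal L * ENNReal.ofReal T ≤ ENNReal.ofReal (L * (1 + T)) := by
              rw [← ENNReal.ofReal_mul hLpos.le]
              exact ENNReal.ofReal_le_ofReal (by nlinarith)
            have h3 : ENNReal.ofReal L ≤ ENNReal.ofReal (L * (1 + T)) :=
              ENNReal.ofReal_le_ofReal (by nlinarith)
            gcongr
            exact le_mul_of_one_le_left zero_le h1
        _ = _ := by rw [hD]; ring) t
  refine hgron.trans (le_of_eq ?_)
  rw [← mul_assoc, ← ENNReal.ofReal_mul (by positivity)]

end Stability

/-! ### Couplings built from a partition -/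

section Coupling

variable {S S' : Type*} [MeasurableSpace S] [MeasurableSpace S']

/-- A partial coupling is completed by the product of the two residual marginals, divided by their
common mass `θ`. If θ = 0 both residuals vanish and nothing is added. -/
theorem exists_coupling_ge (μ : Measure S) (ν : Measure S') [IsProbabilityMeasure μ]
    [IsProbabilityMeasure ν] (m₀ : Measure (S × S')) (hμ : m₀.map Prod.fst ≤ μ)
    (hν : m₀.map Prod.snd ≤ ν) :
    ∃ m : Measure (S × S'), m.map Prod.fst = μ ∧ m.map Prod.snd = ν ∧ m₀ ≤ m := by
  have : IsFiniteMeasure (m₀.map Prod.fst) := isFiniteMeasure_of_le μ hμ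
  have : IsFiniteMeasure (m₀.map Prod.snd) := isFiniteMeasure_of_le ν hν
  set μ' := μ - m₀.map Prod.fst with hμ'
  set ν' := ν - m₀.map Prod.snd with hν'
  set θ := 1 - m₀ Set.univ with hθ
  have hμθ : μ' Set.univ = θ := by
    rw [hμ', Measure.sub_apply .univ hμ, measure_univ, Measure.map_apply measurable_fst .univ,
      Set.preimage_univ]
  have hνθ : ν' Set.univ = θ := by
    rw [hν', Measure.sub_apply .univ hν, measure_univ, Measure.map_apply measurable_snd .univ,
      Set.preimage_univ]
  have hμμ' : m₀.map Prod.fst + μ' = μ := by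
    rw [add_comm]; exact Measure.sub_add_cancel_of_le hμ
  have hνν' : m₀.map Prod.snd + ν' = ν := by
    rw [add_comm]; exact Measure.sub_add_cancel_of_le hν
  have hθtop : θ ≠ ∞ := (tsub_le_self.trans_lt ENNReal.one_lt_top).ne
  have hfin : IsFiniteMeasure ν' := ⟨by rw [hνθ]; exact hθtop.lt_top⟩
  have hfin : IsFiniteMeasure μ' := ⟨by rw [hμθ]; exact hθtop.lt_top⟩
  refine ⟨m₀ + θ⁻¹ • μ'.prod ν', ?_, ?_, Measure.le_add_right le_rfl⟩
  · rw [Measure.map_add _ _ measurable_fst, Measure.map_smul, Measure.map_fst_prod, hνθ, smul_smul]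
    rcases eq_or_ne θ 0 with h | h
    · rw [h, Measure.measure_univ_eq_zero] at hμθ
      rw [hμθ, smul_zero]
      rwa [hμθ] at hμμ'
    · rwa [ENNReal.inv_mul_cancel h hθtop, one_smul]
  · rw [Measure.map_add _ _ measurable_snd, Measure.map_smul, Measure.map_snd_prod, hμθ, smul_smul]
    rcases eq_or_ne θ 0 with h | h
    · rw [h, Measure.measure_univ_eq_zero] at hνθ
      rw [hνθ, smul_zero]
      rwa [hνθ] at hνν'
    · rwa [ENNReal.inv_mul_cancel h hθtop, one_smul]

theorem inv_max_mul_mul_self {a b : ℝ≥0∞} (ha : a ≠ ∞) (hb : b ≠ ∞) :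
    (max a b)⁻¹ * (a * b) = min a b := by
  rcases le_total a b with h | h
  · rw [max_eq_right h, min_eq_left h]
    rcases eq_or_ne b 0 with rfl | hb0
    · simp [nonpos_iff_eq_zero.1 h]
    · rw [mul_comm a, ← mul_assoc, ENNReal.inv_mul_cancel hb0 hb, one_mul]
  · rw [max_eq_left h, min_eq_right h]
    rcases eq_or_ne a 0 with rfl | ha0
    · simp [nonpos_iff_eq_zero.1 h]
    · rw [← mul_assoc, ENNReal.inv_mul_cancel ha0 ha, one_mul]

theorem sum_smul_restrict_le {ι : Type*} (μ : Measure S) (s : Finset ι) {A : ι → Set S}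
    (hA : ∀ i, MeasurableSet (A i)) (hd : Pairwise (Function.onFun Disjoint A)) {c : ι → ℝ≥0∞}
    (hc : ∀ i, c i ≤ 1) : ∑ i ∈ s, c i • μ.restrict (A i) ≤ μ := by
  calc ∑ i ∈ s, c i • μ.restrict (A i) ≤ ∑ i ∈ s, μ.restrict (A i) := by
        refine Finset.sum_le_sum fun i _ => ?_
        refine Measure.le_iff.2 fun B _ => ?_
        rw [Measure.smul_apply, smul_eq_mul]
        exact mul_le_of_le_one_left zero_le (hc i)
    _ ≤ μ := by
        refine Measure.le_iff.2 fun B hB => ?_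
        simp only [Measure.coe_finsetSum, Finset.sum_apply, Measure.restrict_apply hB]
        rw [← measure_biUnion_finset (fun i _ j _ hij => (hd hij).mono Set.inter_subset_right
          Set.inter_subset_right) fun i _ => hB.inter (hA i)]
        exact measure_mono (Set.iUnion₂_subset fun i _ => Set.inter_subset_left)

/-- Two probability measures can be coupled so that the two components lie in the same cell of
a partition, up to an error governed by the masses of the cells. -/
theorem exists_coupling_of_partition {ι : Type*} (μ : Measure S) (ν : Measure S')
    [IsProbabilityMeasure μ] [IsProbabilityMeasure ν] (s : Finset ι) {A : ι → Set S}
    {B : ι → Set S'} (hA : ∀ i, MeasurableSet (A i)) (hB : ∀ i, MeasurableSet (B i))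
    (hAd : Pairwise (Function.onFun Disjoint A)) (hBd : Pairwise (Function.onFun Disjoint B)) :
    ∃ m : Measure (S × S'), m.map Prod.fst = μ ∧ m.map Prod.snd = ν ∧
      m (⋃ i ∈ s, A i ×ˢ B i)ᶜ ≤ 1 - ∑ i ∈ s, min (μ (A i)) (ν (B i)) := by
  -- With this normalisation both marginals of the i-th piece stay below μ and ν, while its mass is
  -- exactly the minimum of the two cell masses.
  set c : ι → ℝ≥0∞ := fun i => (max (μ (A i)) (ν (B i)))⁻¹ with hc
  set m₀ : Measure (S × S') :=
    ∑ i ∈ s, c i • (μ.restrict (A i)).prod (ν.restrict (B i)) with hm₀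
  have h1 : m₀.map Prod.fst ≤ μ := by
    rw [hm₀, Measure.map_finset_sum measurable_fst.aemeasurable]
    simp only [Measure.map_smul, Measure.map_fst_prod, smul_smul, Measure.restrict_apply_univ]
    refine sum_smul_restrict_le μ s hA hAd fun i => ?_
    calc c i * ν (B i) ≤ (max (μ (A i)) (ν (B i)))⁻¹ * max (μ (A i)) (ν (B i)) :=
          mul_le_mul' le_rfl (le_max_right _ _)
      _ ≤ 1 := ENNReal.inv_mul_le_one _
  have h2 : m₀.map Prod.snd ≤ ν := by
    rw [hm₀, Measure.map_finset_sum measurable_snd.aemeasurable]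
    simp only [Measure.map_smul, Measure.map_snd_prod, smul_smul, Measure.restrict_apply_univ]
    refine sum_smul_restrict_le ν s hB hBd fun i => ?_
    calc c i * μ (A i) ≤ (max (μ (A i)) (ν (B i)))⁻¹ * max (μ (A i)) (ν (B i)) :=
          mul_le_mul' le_rfl (le_max_left _ _)
      _ ≤ 1 := ENNReal.inv_mul_le_one _
  obtain ⟨m, hm1, hm2, hm⟩ := exists_coupling_ge μ ν m₀ h1 h2
  have hprob : IsProbabilityMeasure m := ⟨by
    rw [← Set.preimage_univ (f := Prod.fst), ← Measure.map_apply measurable_fst .univ, hm1,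
      measure_univ]⟩
  refine ⟨m, hm1, hm2, ?_⟩
  have hG : MeasurableSet (⋃ i ∈ s, A i ×ˢ B i) :=
    Finset.measurableSet_biUnion _ fun i _ => (hA i).prod (hB i)
  rw [prob_compl_eq_one_sub hG]
  refine tsub_le_tsub_left (le_trans ?_ (hm _)) _
  simp only [hm₀, Measure.coe_finsetSum, Finset.sum_apply, Measure.smul_apply, smul_eq_mul]
  refine Finset.sum_le_sum fun i hi => ?_
  calc min (μ (A i)) (ν (B i)) = c i * (μ (A i) * ν (B i)) :=
        (inv_max_mul_mul_self (measure_ne_top _ _) (measure_ne_top _ _)).symm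
    _ = c i * (μ.restrict (A i)).prod (ν.restrict (B i)) (A i ×ˢ B i) := by
        rw [Measure.prod_prod, Measure.restrict_apply_self, Measure.restrict_apply_self]
    _ ≤ _ := by
        gcongr
        exact Set.subset_biUnion_of_mem (u := fun i => A i ×ˢ B i) hi

end Coupling

/-- The three terms bound f^p where f ≤ ε, where ε < f ≤ M, and where f > M; in the last range f^p ≤
M^{p-p'} f^{p'}. This is where a p'-moment controls the tail in L^p. -/
theorem lintegral_rpow_le_of_measure_lt {S : Type*} [MeasurableSpace S] {m : Measure S}
    [IsProbabilityMeasure m] {p p' : ℝ} (hp : 0 < p) (hpp' : p < p') {f : S → ℝ≥0∞}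
    (hf : Measurable f) (ε : ℝ≥0∞) {M : ℝ≥0∞} (hM : 0 < M) (hM' : M ≠ ∞) :
    ∫⁻ s, f s ^ p ∂m ≤
      ε ^ p + M ^ p * m {s | ε < f s} + M ^ (p - p') * ∫⁻ s, f s ^ p' ∂m := by
  have hms : MeasurableSet {s | ε < f s} := measurableSet_lt measurable_const hf
  calc ∫⁻ s, f s ^ p ∂m ≤ ∫⁻ s, ((ε ^ p + M ^ p * {s | ε < f s}.indicator 1 s) +
        M ^ (p - p') * f s ^ p') ∂m := by
        refine lintegral_mono fun s => ?_
        dsimp only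
        rcases le_or_gt (f s) ε with h | h
        · exact (ENNReal.rpow_le_rpow h hp.le).trans (le_self_add.trans le_self_add)
        · rcases le_or_gt (f s) M with h' | h'
          · rw [Set.indicator_of_mem (by exact h), Pi.one_apply, mul_one]
            exact (ENNReal.rpow_le_rpow h' hp.le).trans (le_add_self.trans le_self_add)
          · refine le_trans ?_ le_add_self
            have hf0 : f s ≠ 0 := (hM.trans h').ne'
            rcases eq_or_ne (f s) ∞ with ht | ht
            · have : M ^ (p - p') ≠ 0 := by
                simp [ENNReal.rpow_eq_zero_iff, hM.ne', hM']
              rw [ht, ENNReal.top_rpow_of_pos hp, ENNReal.top_rpow_of_pos (hp.trans hpp'),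
                ENNReal.mul_top this]
            · calc f s ^ p = f s ^ (p - p') * f s ^ p' := by
                    rw [← ENNReal.rpow_add _ _ hf0 ht]; simp
                _ ≤ M ^ (p - p') * f s ^ p' := by
                    refine mul_le_mul' ?_ le_rfl
                    rw [← neg_sub, ENNReal.rpow_neg, ENNReal.rpow_neg, ENNReal.inv_le_inv]
                    exact ENNReal.rpow_le_rpow h'.le (by linarith)
    _ = _ := by
        rw [lintegral_add_left (by fun_prop (disch := assumption)), lintegral_add_left (by fun_prop),
          lintegral_const_mul _ (by fun_prop (disch := assumption)),
          lintegral_const_mul _ (by fun_prop), lintegral_indicator_one hms]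
        simp

/-! ### Stability of the laws of solutions -/

theorem eLpNorm'_const_mul_ennreal {S : Type*} [MeasurableSpace S] {m : Measure S} {p : ℝ}
    (hp : 0 < p) {c : ℝ≥0∞} (hc : c ≠ ∞) (f : S → ℝ≥0∞) :
    eLpNorm' (fun s => c * f s) p m = c * eLpNorm' f p m := by
  simp only [eLpNorm'_eq_lintegral_enorm, enorm_eq_self, ENNReal.mul_rpow_of_nonneg _ _ hp.le]
  rw [lintegral_const_mul' _ _ (ENNReal.rpow_ne_top_of_nonneg hp.le hc),
    ENNReal.mul_rpow_of_nonneg _ _ (by positivity), ← ENNReal.rpow_mul, mul_one_div_cancel hp.ne',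
    ENNReal.rpow_one]

theorem continuous_pairPath {T : ℝ} {d n : ℕ} :
    Continuous fun z : PathSpace T (Euc d) × PathSpace T (Euc n) => pairPath z.1 z.2 := by
  refine ContinuousMap.continuous_of_continuous_uncurry _ ?_
  simp only [Function.uncurry_def, pairPath, ContinuousMap.coe_mk]
  fun_prop

theorem measurable_pairPath {T : ℝ} {d n : ℕ} {S : Type*} [MeasurableSpace S]
    {x : S → PathSpace T (Euc d)} {r : S → PathSpace T (Euc n)} (hx : Measurable x)
    (hr : Measurable r) : Measurable fun s => pairPath (x s) (r s) :=
  continuous_pairPath.measurable.comp (hx.prodMk hr)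

theorem measurable_pairPath_apply {T : ℝ} {d n : ℕ} {S : Type*} [MeasurableSpace S]
    {x : S → PathSpace T (Euc d)} {r : S → PathSpace T (Euc n)} (hx : Measurable x)
    (hr : Measurable r) (t : Set.Icc (0 : ℝ) T) : Measurable fun s => pairPath (x s) (r s) t :=
  (show Continuous fun f : PathSpace T (EucPair d n) => f t by fun_prop).measurable.comp
    (measurable_pairPath hx hr)

section Stability

variable {T p : ℝ} {d n : ℕ}

/-- With both solutions on one space, `m` couples their laws at every time, so the distance of the
flows is at most the L^p distance of the solutions. Inserting the pathwise estimate closes a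
Gronwall inequality for that distance. How the inputs depend on one another under `m` is irrelevant.
-/
theorem exists_wasserstein_map_pairPath_le.{v} (hT : 0 < T) (hp : 1 ≤ p) {b : Drift T p d n}
    {K : ℝ≥0} (hb_lip : ∀ (t : Set.Icc (0 : ℝ) T) (x x' : EucPair d n)
      (μ μ' : FiniteMomentMeasure p (EucPair d n)),
      ‖b t x μ - b t x' μ'‖ₑ ^ p ≤
        K * (‖x - x'‖ₑ ^ p + wasserstein p μ.toMeasure μ'.toMeasure ^ p)) :
    ∃ C : ℝ, 0 < C ∧ ∀ {S : Type v} [MeasurableSpace S] (m : Measure S) [IsProbabilityMeasure m]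
      (μ ν : Set.Icc (0 : ℝ) T → FiniteMomentMeasure p (EucPair d n))
      (x₀ y₀ : S → Euc d) (w v : S → PathSpace T (Euc d)) (r q : S → PathSpace T (Euc n))
      (x y : S → PathSpace T (Euc d)), Measurable x₀ → Measurable y₀ → Measurable w →
      Measurable v → Measurable r → Measurable q → Measurable x → Measurable y →
      (∀ t, m.map (fun s => pairPath (x s) (r s) t) = (μ t).toMeasure) →
      (∀ t, m.map (fun s => pairPath (y s) (q s) t) = (ν t).toMeasure) →
      (∀ᵐ s ∂m, SolvesIntegralEquation b μ (x₀ s) (w s) (r s) (x s)) →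
      (∀ᵐ s ∂m, SolvesIntegralEquation b ν (y₀ s) (v s) (q s) (y s)) →
      eLpNorm' (fun s => edist (x s) (y s)) p m ≠ ∞ →
      wasserstein p (m.map fun s => pairPath (x s) (r s)) (m.map fun s => pairPath (y s) (q s)) ≤
        ENNReal.ofReal C * eLpNorm'
          (fun s => edist (x₀ s) (y₀ s) + edist (w s) (v s) + edist (r s) (q s)) p m := by
  obtain ⟨C, hC, hpath⟩ := exists_edist_le_of_solvesIntegralEquation hT hp hb_lip
  have hp0 : 0 < p := by linarith
  set G : ℝ := 2 * Real.exp (2 * C * T) with hG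
  -- `C + 1` collects the pathwise constant and the direct r-distance; `G * (C + 1)` is the Gronwall
  -- bound on the flow distance, then integrated over [0,T] and multiplied by C.
  refine ⟨(C + 1) + C * (T * (G * (C + 1))), by positivity, ?_⟩
  intro S _ m _ μ ν x₀ y₀ w v r q x y hx₀ hy₀ hw hv hr hq hx hy hμ hν hxs hys hfin
  set A : S → ℝ≥0∞ := fun s => edist (x₀ s) (y₀ s) + edist (w s) (v s) + edist (r s) (q s) with hA
  have hAm : Measurable A := by fun_prop
  set a := eLpNorm' A p m with ha
  rcases eq_or_ne a ∞ with hatop | hatop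
  · rw [hatop, ENNReal.mul_top (by simp; positivity)]
    exact le_top
  set Wt : Set.Icc (0 : ℝ) T → ℝ≥0∞ := fun t =>
    wasserstein p (μ t).toMeasure (ν t).toMeasure with hWt
  have hconst : ∀ c c' : ℝ≥0∞, c ≠ ∞ → eLpNorm' (fun s => c * A s + c') p m ≤ c * a + c' :=
    fun c c' hc => by
    refine (eLpNorm'_add_le (f := fun s => c * A s) (g := fun _ => c')
      (by fun_prop) (by fun_prop) hp).trans ?_
    rw [eLpNorm'_const_mul_ennreal hp0 hc, eLpNorm'_const _ hp0]
    simp [ha]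
  have hpath' : ∀ᵐ s ∂m, ∀ t, edist (x s t) (y s t) ≤ ENNReal.ofReal C *
      (A s + ∫⁻ s in Set.Iic t, Wt s ∂(lebesgueIcc T)) := by
    filter_upwards [hxs, hys] with s h1 h2
    exact hpath _ _ _ _ _ _ _ _ _ _ h1 h2
  have hrq : ∀ s, edist (r s) (q s) ≤ A s := fun s => le_add_self
  have hWle : ∀ t (f : S → ℝ≥0∞), (∀ᵐ s ∂m, edist (x s t) (y s t) + edist (r s) (q s) ≤ f s) →
      Wt t ≤ eLpNorm' f p m := fun t f hf => by
    refine (wasserstein_le_of_coupling hp0.le (measurable_pairPath_apply hx hr t)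
      (measurable_pairPath_apply hy hq t) (hμ t) (hν t)).trans ?_
    refine eLpNorm'_mono_enorm_ae (f := fun s => edist (pairPath (x s) (r s) t)
      (pairPath (y s) (q s) t)) hp0.le ?_
    filter_upwards [hf] with s hs
    rw [enorm_eq_self, enorm_eq_self]
    exact ((edist_pair_le _ _ _ _).trans
      (add_le_add le_rfl (edist_apply_le_edist _ _ t))).trans hs
  -- The finite a priori bound that Gronwall requires.
  have hWbd : ∀ t, Wt t ≤ eLpNorm' (fun s => edist (x s) (y s)) p m + a := fun t => by
    refine (hWle t (fun s => edist (x s) (y s) + A s) (ae_of_all _ fun s =>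
      add_le_add (edist_apply_le_edist _ _ t) (hrq s))).trans ?_
    exact eLpNorm'_add_le (f := fun s => edist (x s) (y s)) (by fun_prop) (by fun_prop) hp
  have harith : ∀ s (e J : ℝ≥0∞), e ≤ ENNReal.ofReal C * (A s + J) →
      e + edist (r s) (q s) ≤ ENNReal.ofReal (C + 1) * A s + ENNReal.ofReal C * J :=
    fun s e J h => by
    calc e + edist (r s) (q s) ≤ ENNReal.ofReal C * (A s + J) + A s := add_le_add h (hrq s)
      _ = _ := by rw [ENNReal.ofReal_add hC.le zero_le_one, ENNReal.ofReal_one]; ring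
  have hWgron : ∀ t, Wt t ≤ ENNReal.ofReal G * (ENNReal.ofReal (C + 1) * a) :=
    le_of_le_add_lintegral hC (ENNReal.add_ne_top.2 ⟨hfin, hatop⟩) hWbd fun t =>
      (hWle t _ (hpath'.mono fun s hs => harith s _ _ (hs t))).trans
        (hconst _ _ ENNReal.ofReal_ne_top)
  have hJ : ∀ t, ∫⁻ s in Set.Iic t, Wt s ∂(lebesgueIcc T) ≤
      ENNReal.ofReal T * (ENNReal.ofReal G * (ENNReal.ofReal (C + 1) * a)) := fun t => by
    refine (lintegral_mono hWgron).trans ?_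
    rw [lintegral_const, mul_comm, Measure.restrict_apply_univ]
    gcongr
    exact (measure_mono (Set.subset_univ _)).trans (lebesgueIcc_univ T).le
  refine (wasserstein_le_of_coupling hp0.le (measurable_pairPath hx hr)
    (measurable_pairPath hy hq) rfl rfl).trans ?_
  refine (eLpNorm'_mono_enorm_ae (f := fun s => edist (pairPath (x s) (r s))
      (pairPath (y s) (q s))) (g := fun s => ENNReal.ofReal (C + 1) * A s + ENNReal.ofReal C *
      (ENNReal.ofReal T * (ENNReal.ofReal G * (ENNReal.ofReal (C + 1) * a)))) hp0.le ?_).trans ?_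
  · filter_upwards [hpath'] with s hs
    rw [enorm_eq_self, enorm_eq_self]
    refine (edist_pairPath_le _ _ _ _).trans (harith s _ _ ?_)
    rw [ContinuousMap.edist_eq_iSup]
    refine iSup_le fun t => (hs t).trans ?_
    gcongr
    exact hJ t
  · refine (hconst _ _ ENNReal.ofReal_ne_top).trans (le_of_eq ?_)
    have hGpos : 0 ≤ G := by positivity
    clear_value G
    rw [ENNReal.ofReal_add (p := C + 1) (by positivity) (by positivity), ENNReal.ofReal_mul hC.le,
      ENNReal.ofReal_mul hT.le, ENNReal.ofReal_mul hGpos]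
    ring

/-- The solution of a McKean-Vlasov equation inherits the integrability of its inputs. -/
theorem memLp_of_solvesMcKeanVlasov (hT : 0 < T) (hp : 1 ≤ p) {b : Drift T p d n}
    {K : ℝ≥0} (hb_lip : ∀ (t : Set.Icc (0 : ℝ) T) (x x' : EucPair d n)
      (μ μ' : FiniteMomentMeasure p (EucPair d n)),
      ‖b t x μ - b t x' μ'‖ₑ ^ p ≤
        K * (‖x - x'‖ₑ ^ p + wasserstein p μ.toMeasure μ'.toMeasure ^ p))
    {Ω : Type*} [MeasurableSpace Ω] {P : Measure Ω} [IsProbabilityMeasure P] {ζ : Ω → Euc d}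
    {W : Ω → PathSpace T (Euc d)} {R : Ω → PathSpace T (Euc n)} {X : Ω → PathSpace T (Euc d)}
    (hX : SolvesMcKeanVlasov b P ζ W R X) {s : ℝ≥0∞} (hζ : MemLp ζ s P) (hW : MemLp W s P)
    (hR : MemLp R s P) : MemLp X s P := by
  obtain ⟨C, hC, hpath⟩ := exists_edist_le_of_solvesIntegralEquation hT hp hb_lip
  obtain ⟨hXm, μ, -, hsol⟩ := hX
  -- Compare almost every path with one reference path. Both have the same measure flow, so the
  -- Wasserstein term vanishes and ‖X‖ grows at most linearly in the inputs.
  obtain ⟨ω₀, hω₀⟩ := hsol.exists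
  have h1 : MemLp (fun ω => ‖ζ ω - ζ ω₀‖) s P := (hζ.sub (memLp_const (ζ ω₀))).norm
  have h2 : MemLp (fun ω => ‖W ω - W ω₀‖) s P := (hW.sub (memLp_const (W ω₀))).norm
  have h3 : MemLp (fun ω => ‖R ω - R ω₀‖) s P := (hR.sub (memLp_const (R ω₀))).norm
  have hg : MemLp (fun ω => ‖X ω₀‖ + C * (‖ζ ω - ζ ω₀‖ + ‖W ω - W ω₀‖ + ‖R ω - R ω₀‖)) s P :=
    (memLp_const ‖X ω₀‖).add (((h1.add h2).add h3).const_mul C)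
  refine hg.mono hXm.aestronglyMeasurable ?_
  filter_upwards [hsol] with ω hω
  have h : edist (X ω) (X ω₀) ≤ ENNReal.ofReal C *
      (edist (ζ ω) (ζ ω₀) + edist (W ω) (W ω₀) + edist (R ω) (R ω₀)) := by
    rw [ContinuousMap.edist_eq_iSup]
    refine iSup_le fun t => (hpath _ _ _ _ _ _ _ _ _ _ hω hω₀ t).trans ?_
    simp [wasserstein_self (by linarith : 0 < p)]
  rw [edist_dist, edist_dist, edist_dist, edist_dist, ← ENNReal.ofReal_add (by positivity)
    (by positivity), ← ENNReal.ofReal_add (by positivity) (by positivity),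
    ← ENNReal.ofReal_mul hC.le, ENNReal.ofReal_le_ofReal_iff (by positivity)] at h
  simp only [dist_eq_norm] at h
  rw [Real.norm_of_nonneg (by positivity)]
  calc ‖X ω‖ = ‖X ω₀ + (X ω - X ω₀)‖ := by congr 1; abel
    _ ≤ ‖X ω₀‖ + ‖X ω - X ω₀‖ := norm_add_le _ _
    _ ≤ _ := by gcongr

end Stability

/-! ### A law of large numbers with independent weights -/

theorem indicator_one_mem_Icc {E : Type*} (S : Set E) (x : E) :
    S.indicator (1 : E → ℝ) x ∈ Set.Icc (0 : ℝ) 1 := by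
  by_cases h : x ∈ S <;> simp [h]

theorem abs_indicator_one_le {E : Type*} (S : Set E) (x : E) :
    |S.indicator (1 : E → ℝ) x| ≤ 1 := by
  by_cases h : x ∈ S <;> simp [h]

section LawOfLargeNumbers

variable {Ω : Type*} [MeasurableSpace Ω] {P : Measure Ω} [IsProbabilityMeasure P]

/-- Hoeffding's inequality with deterministic weights. -/
theorem measure_sum_weighted_ge_le {N : ℕ} {U : Fin N → Ω → ℝ} (hU : ∀ i, Measurable (U i))
    (hU01 : ∀ i ω, U i ω ∈ Set.Icc (0 : ℝ) 1) (hindep : iIndepFun U P) {u : ℝ}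
    (hmean : ∀ i, ∫ ω, U i ω ∂P = u) {v : Fin N → ℝ} (hv : ∀ i, |v i| ≤ 1) {ε : ℝ} (hε : 0 ≤ ε) :
    P {ω | ε * N ≤ ∑ i, (U i ω - u) * v i} ≤ ENNReal.ofReal (Real.exp (-(ε ^ 2 / 2)) ^ N) := by
  have hsub : ∀ i, HasSubgaussianMGF (fun ω => (U i ω - u) * v i) 1 P := fun i => by
    -- The range [-1,1] has half-width 1, hence variance proxy 1.
    have h := hasSubgaussianMGF_of_mem_Icc (μ := P) (X := fun ω => U i ω * v i) (a := -1) (b := 1)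
      (by fun_prop) (ae_of_all _ fun ω => by
        have h1 := hU01 i ω
        have h2 := abs_le.1 (hv i)
        constructor <;> nlinarith [h1.1, h1.2, h2.1, h2.2])
    rw [integral_mul_const, hmean] at h
    have h2 : (‖(1 : ℝ) - -1‖₊ / 2) ^ 2 = (1 : ℝ≥0) := by
      have : ‖(1 : ℝ) - -1‖₊ = 2 := by
        rw [← NNReal.coe_inj, coe_nnnorm]; norm_num
      rw [this]; norm_num
    rw [h2] at h
    simpa only [sub_mul] using h
  have hi : iIndepFun (fun i ω => (U i ω - u) * v i) P :=
    hindep.comp (fun i x => (x - u) * v i) fun i => by fun_prop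
  have h := HasSubgaussianMGF.measure_sum_ge_le_of_iIndepFun hi (s := Finset.univ)
    (fun i _ => hsub i) (ε := ε * N) (by positivity)
  rw [Measure.real, ← ENNReal.le_ofReal_iff_toReal_le (measure_ne_top _ _) (by positivity)] at h
  refine h.trans (ENNReal.ofReal_le_ofReal (le_of_eq ?_))
  rw [← Real.exp_nat_mul]
  congr 1
  simp only [Finset.sum_const, Finset.card_univ, Fintype.card_fin, nsmul_eq_mul, mul_one,
    NNReal.coe_natCast]
  rcases eq_or_ne (N : ℝ) 0 with h0 | h0
  · simp [h0]
  · field_simp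

/-- Integrate the deterministic-weight bound over the law of V by Fubini; it is uniform in the
weights. The weights may depend on each other arbitrarily. -/
theorem measure_sum_indep_weighted_ge_le {N : ℕ} {U V : Fin N → Ω → ℝ}
    (hU : ∀ i, Measurable (U i)) (hV : ∀ i, Measurable (V i))
    (hU01 : ∀ i ω, U i ω ∈ Set.Icc (0 : ℝ) 1) (hV1 : ∀ i ω, |V i ω| ≤ 1) (hindep : iIndepFun U P)
    {u : ℝ} (hmean : ∀ i, ∫ ω, U i ω ∂P = u)
    (hUV : IndepFun (fun ω i => U i ω) (fun ω i => V i ω) P) {ε : ℝ} (hε : 0 ≤ ε) :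
    P {ω | ε * N ≤ ∑ i, (U i ω - u) * V i ω} ≤ ENNReal.ofReal (Real.exp (-(ε ^ 2 / 2)) ^ N) := by
  have hUm : Measurable fun ω i => U i ω := measurable_pi_lambda _ hU
  have hVm : Measurable fun ω i => V i ω := measurable_pi_lambda _ hV
  set D : Set ((Fin N → ℝ) × (Fin N → ℝ)) := {z | ε * N ≤ ∑ i, (z.1 i - u) * z.2 i} with hD
  have hDm : MeasurableSet D := measurableSet_le measurable_const (by fun_prop)
  have := Measure.isProbabilityMeasure_map (μ := P) hUm.aemeasurable
  have := Measure.isProbabilityMeasure_map (μ := P) hVm.aemeasurable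
  calc P {ω | ε * N ≤ ∑ i, (U i ω - u) * V i ω}
      = (P.map fun ω => ((fun i => U i ω), (fun i => V i ω))) D := by
        rw [Measure.map_apply (hUm.prodMk hVm) hDm]; rfl
    _ = ∫⁻ ω, (P.map fun ω i => U i ω) ((fun a => (a, fun i => V i ω)) ⁻¹' D) ∂P := by
        rw [hUV.map_prod_eq_prod_map_map hUm.aemeasurable hVm.aemeasurable,
          Measure.prod_apply_symm hDm, lintegral_map (measurable_measure_prodMk_right hDm) hVm]
    _ ≤ ∫⁻ _, ENNReal.ofReal (Real.exp (-(ε ^ 2 / 2)) ^ N) ∂P := by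
        refine lintegral_mono fun ω => ?_
        rw [Measure.map_apply hUm (measurable_prodMk_right hDm)]
        exact measure_sum_weighted_ge_le hU hU01 hindep hmean (fun i => hV1 i ω) hε
    _ = _ := by simp

/-- The Hoeffding bounds are geometric in N, so Borel–Cantelli applies although the weights change
with N and nothing relates different N. -/
theorem ae_tendsto_weighted_average {U : ℕ → Ω → ℝ} {V : (N : ℕ) → Fin N → Ω → ℝ}
    (hU : ∀ i, Measurable (U i)) (hV : ∀ N i, Measurable (V N i))
    (hU01 : ∀ i ω, U i ω ∈ Set.Icc (0 : ℝ) 1) (hV1 : ∀ N i ω, |V N i ω| ≤ 1)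
    (hindep : iIndepFun U P) {u : ℝ} (hmean : ∀ i, ∫ ω, U i ω ∂P = u)
    (hUV : ∀ N, IndepFun (fun ω (i : Fin N) => U i ω) (fun ω i => V N i ω) P) :
    ∀ᵐ ω ∂P, Tendsto (fun N : ℕ => (∑ i : Fin N, (U i ω - u) * V N i ω) / N) atTop (𝓝 0) := by
  have hind : ∀ N : ℕ, iIndepFun (fun i : Fin N => U i) P := fun N =>
    hindep.precomp (g := fun i : Fin N => (i : ℕ)) Fin.val_injective
  have hUVneg : ∀ N, IndepFun (fun ω (i : Fin N) => U i ω) (fun ω i => -V N i ω) P := fun N =>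
    (hUV N).comp (φ := id) (ψ := fun (x : Fin N → ℝ) i => -x i) measurable_id (by fun_prop)
  have hBC : ∀ k : ℕ, ∀ᵐ ω ∂P, ∀ᶠ N : ℕ in atTop,
      |∑ i : Fin N, (U i ω - u) * V N i ω| < 1 / ((k : ℝ) + 1) * N := fun k => by
    set ε : ℝ := 1 / ((k : ℝ) + 1) with hε
    have hεpos : 0 < ε := by positivity
    have hsum : ∑' N : ℕ, ENNReal.ofReal (Real.exp (-(ε ^ 2 / 2)) ^ N) ≠ ∞ := by
      refine Summable.tsum_ofReal_ne_top (summable_geometric_of_lt_one (Real.exp_pos _).le ?_)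
      rw [Real.exp_lt_one_iff]
      have : 0 < ε ^ 2 / 2 := by positivity
      linarith
    have h1 := ae_eventually_notMem (μ := P)
      (s := fun N : ℕ => {ω | ε * N ≤ ∑ i : Fin N, (U i ω - u) * V N i ω})
      (ne_top_of_le_ne_top hsum (ENNReal.tsum_le_tsum fun N =>
        measure_sum_indep_weighted_ge_le (fun i => hU i) (hV N) (fun i => hU01 i) (hV1 N)
          (hind N) (fun i => hmean i) (hUV N) hεpos.le))
    have h2 := ae_eventually_notMem (μ := P)
      (s := fun N : ℕ => {ω | ε * N ≤ ∑ i : Fin N, (U i ω - u) * -V N i ω})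
      (ne_top_of_le_ne_top hsum (ENNReal.tsum_le_tsum fun N =>
        measure_sum_indep_weighted_ge_le (fun i => hU i) (fun i => (hV N i).neg) (fun i => hU01 i)
          (fun i ω => by rw [Pi.neg_apply, abs_neg]; exact hV1 N i ω)
          (hind N) (fun i => hmean i) (hUVneg N) hεpos.le))
    filter_upwards [h1, h2] with ω h1 h2
    filter_upwards [h1, h2] with N h1 h2
    simp only [not_le, mul_neg, Finset.sum_neg_distrib] at h1 h2
    exact abs_lt.2 ⟨by linarith, h1⟩
  filter_upwards [ae_all_iff.2 hBC] with ω hω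
  -- The version with N > n guarantees N > 0, as needed to divide.
  rw [Metric.tendsto_atTop']
  intro δ hδ
  obtain ⟨k, hk⟩ := exists_nat_one_div_lt hδ
  obtain ⟨n, hn⟩ := eventually_atTop.1 (hω k)
  refine ⟨n, fun N hN => ?_⟩
  have hNpos : (0 : ℝ) < N := by exact_mod_cast (Nat.zero_le n).trans_lt hN
  rw [Real.dist_eq, sub_zero, abs_div, abs_of_pos hNpos]
  refine lt_of_lt_of_le ?_ hk.le
  rw [div_lt_iff₀ hNpos]
  exact hn N hN.le

/-- Reassociate the product (X, Y), Z of laws. This permits weights built from (W, R) in the average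
over ζ. -/
theorem IndepFun.indepFun_prodMk_of_indepFun_prodMk {E₁ E₂ E₃ : Type*} [MeasurableSpace E₁]
    [MeasurableSpace E₂] [MeasurableSpace E₃] {X : Ω → E₁} {Y : Ω → E₂} {Z : Ω → E₃}
    (hX : Measurable X) (hY : Measurable Y) (hZ : Measurable Z) (hXY : IndepFun X Y P)
    (hZXY : IndepFun Z (fun ω => (X ω, Y ω)) P) : IndepFun X (fun ω => (Y ω, Z ω)) P := by
  have hZY : IndepFun Y Z P := (hZXY.comp (φ := id) measurable_id measurable_snd).symm
  have hassoc := hZXY.symm.map_prod_eq_prod_map_map (hX.prodMk hY).aemeasurable hZ.aemeasurable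
  rw [hXY.map_prod_eq_prod_map_map hX.aemeasurable hY.aemeasurable] at hassoc
  have := Measure.isProbabilityMeasure_map (μ := P) hX.aemeasurable
  have := Measure.isProbabilityMeasure_map (μ := P) hY.aemeasurable
  have := Measure.isProbabilityMeasure_map (μ := P) hZ.aemeasurable
  rw [indepFun_iff_map_prod_eq_prod_map_map hX.aemeasurable (hY.prodMk hZ).aemeasurable,
    hZY.map_prod_eq_prod_map_map hY.aemeasurable hZ.aemeasurable, ← Measure.prodAssoc_prod,
    ← hassoc, Measure.map_map MeasurableEquiv.prodAssoc.measurable ((hX.prodMk hY).prodMk hZ)]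
  rfl

/-- With a and b the probabilities of A and B, telescope: 1_A 1_B 1_C = (1_A - a) 1_B 1_C + a (1_B -
b) 1_C + ab 1_C. The first two averages vanish by the weighted law of large numbers; the third
converges by assumption. -/
theorem ae_tendsto_average_indicator_mul {E₁ E₂ E₃ : Type*} [MeasurableSpace E₁]
    [MeasurableSpace E₂] [MeasurableSpace E₃] {X : ℕ → Ω → E₁} {Y : ℕ → Ω → E₂}
    {Z : (N : ℕ) → Fin N → Ω → E₃} (hX : ∀ i, Measurable (X i)) (hY : ∀ i, Measurable (Y i))
    (hZ : ∀ N i, Measurable (Z N i)) (hX_indep : iIndepFun X P)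
    (hX_ident : ∀ i, IdentDistrib (X i) (X 0) P P) (hY_indep : iIndepFun Y P)
    (hY_ident : ∀ i, IdentDistrib (Y i) (Y 0) P P)
    (hXY : IndepFun (fun ω i => X i ω) (fun ω i => Y i ω) P)
    (hZXY : ∀ N, IndepFun (fun ω i => Z N i ω) (fun ω => ((fun i => X i ω), (fun i => Y i ω))) P)
    {A : Set E₁} {B : Set E₂} {C : Set E₃} (hA : MeasurableSet A) (hB : MeasurableSet B)
    (hC : MeasurableSet C) {c : ℝ} (hlim : ∀ᵐ ω ∂P, Tendsto
      (fun N : ℕ => (∑ i : Fin N, C.indicator (1 : E₃ → ℝ) (Z N i ω)) / N) atTop (𝓝 c)) :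
    ∀ᵐ ω ∂P, Tendsto (fun N : ℕ => (∑ i : Fin N, A.indicator (1 : E₁ → ℝ) (X i ω) *
      (B.indicator (1 : E₂ → ℝ) (Y i ω) * C.indicator (1 : E₃ → ℝ) (Z N i ω))) / N) atTop
      (𝓝 (P.real (X 0 ⁻¹' A) * (P.real (Y 0 ⁻¹' B) * c))) := by
  have hAi : Measurable (A.indicator (1 : E₁ → ℝ)) := measurable_one.indicator hA
  have hBi : Measurable (B.indicator (1 : E₂ → ℝ)) := measurable_one.indicator hB
  have hCi : Measurable (C.indicator (1 : E₃ → ℝ)) := measurable_one.indicator hC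
  have hXs : Measurable fun ω i => X i ω := measurable_pi_lambda _ hX
  have hYs : Measurable fun ω i => Y i ω := measurable_pi_lambda _ hY
  have hXmean : ∀ i, ∫ ω, A.indicator (1 : E₁ → ℝ) (X i ω) ∂P = P.real (X 0 ⁻¹' A) := fun i => by
    exact ((hX_ident i).comp hAi).integral_eq.trans (integral_indicator_one (hX 0 hA))
  have hYmean : ∀ i, ∫ ω, B.indicator (1 : E₂ → ℝ) (Y i ω) ∂P = P.real (Y 0 ⁻¹' B) := fun i => by
    exact ((hY_ident i).comp hBi).integral_eq.trans (integral_indicator_one (hY 0 hB))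
  have h1 := ae_tendsto_weighted_average (P := P)
    (U := fun i ω => A.indicator (1 : E₁ → ℝ) (X i ω))
    (V := fun N i ω => B.indicator (1 : E₂ → ℝ) (Y i ω) * C.indicator (1 : E₃ → ℝ) (Z N i ω))
    (fun i => hAi.comp (hX i)) (fun N i => (hBi.comp (hY i)).mul (hCi.comp (hZ N i)))
    (fun i ω => indicator_one_mem_Icc _ _) (fun N i ω => by
      rw [abs_mul]
      exact mul_le_one₀ (abs_indicator_one_le _ _) (abs_nonneg _) (abs_indicator_one_le _ _))
    (hX_indep.comp _ fun _ => hAi) hXmean (fun N =>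
      (IndepFun.indepFun_prodMk_of_indepFun_prodMk hXs hYs (measurable_pi_lambda _ (hZ N)) hXY
        (hZXY N)).comp (φ := fun (x : ℕ → E₁) (i : Fin N) => A.indicator (1 : E₁ → ℝ) (x i))
        (ψ := fun (y : (ℕ → E₂) × (Fin N → E₃)) (i : Fin N) =>
          B.indicator (1 : E₂ → ℝ) (y.1 i) *
            C.indicator (1 : E₃ → ℝ) (y.2 i)) (by fun_prop) (by fun_prop))
  have h2 := ae_tendsto_weighted_average (P := P)
    (U := fun i ω => B.indicator (1 : E₂ → ℝ) (Y i ω))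
    (V := fun N i ω => C.indicator (1 : E₃ → ℝ) (Z N i ω))
    (fun i => hBi.comp (hY i)) (fun N i => hCi.comp (hZ N i))
    (fun i ω => indicator_one_mem_Icc _ _) (fun N i ω => abs_indicator_one_le _ _)
    (hY_indep.comp _ fun _ => hBi) hYmean (fun N =>
      (hZXY N).symm.comp (φ := fun (x : (ℕ → E₁) × (ℕ → E₂)) (i : Fin N) =>
          B.indicator (1 : E₂ → ℝ) (x.2 i))
        (ψ := fun (z : Fin N → E₃) (i : Fin N) => C.indicator (1 : E₃ → ℝ) (z i)) (by fun_prop) (by fun_prop))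
  filter_upwards [h1, h2, hlim] with ω h1 h2 h3
  have h := (h1.add (h2.const_mul (P.real (X 0 ⁻¹' A)))).add
    (h3.const_mul (P.real (X 0 ⁻¹' A) * P.real (Y 0 ⁻¹' B)))
  rw [mul_zero, add_zero, zero_add, mul_assoc] at h
  refine h.congr fun N => ?_
  simp only [← mul_div_assoc, ← add_div, Finset.mul_sum, ← Finset.sum_add_distrib]
  congr 1
  exact Finset.sum_congr rfl fun i _ => by ring

end LawOfLargeNumbers

/-! ### Consequences of Wasserstein convergence -/

section Wasserstein

theorem wasserstein_rpow {E : Type*} [PseudoEMetricSpace E] [MeasurableSpace E] {p : ℝ}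
    (hp : 0 < p) (μ ν : Measure E) : wasserstein p μ ν ^ p =
      ⨅ (m : Measure (E × E)) (_ : m.map Prod.fst = μ ∧ m.map Prod.snd = ν),
        ∫⁻ z, edist z.1 z.2 ^ p ∂m := by
  rw [wasserstein, ← ENNReal.rpow_mul, one_div_mul_cancel hp.ne', ENNReal.rpow_one]

theorem wasserstein_comm {E : Type*} [PseudoEMetricSpace E] [MeasurableSpace E] {p : ℝ}
    (μ ν : Measure E) : wasserstein p μ ν = wasserstein p ν μ := by
  have key : ∀ μ ν : Measure E, (⨅ (m : Measure (E × E))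
      (_ : m.map Prod.fst = μ ∧ m.map Prod.snd = ν), ∫⁻ z, edist z.1 z.2 ^ p ∂m) ≤
      ⨅ (m : Measure (E × E)) (_ : m.map Prod.fst = ν ∧ m.map Prod.snd = μ),
        ∫⁻ z, edist z.1 z.2 ^ p ∂m := fun μ ν => by
    refine le_iInf₂ fun m hm => (iInf₂_le (m.map Prod.swap) ⟨?_, ?_⟩).trans
      ((lintegral_map_le _ _).trans (le_of_eq (lintegral_congr fun z => by
        rw [edist_comm]; rfl)))
    · rw [Measure.map_map measurable_fst measurable_swap]
      exact hm.2
    · rw [Measure.map_map measurable_snd measurable_swap]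
      exact hm.1
  rw [wasserstein, wasserstein, le_antisymm (key μ ν) (key ν μ)]

/-- Under any coupling, if the first point lies in F then the second lies in the δ-thickening or the
points are at distance at least δ; Markov's inequality bounds the latter event. -/
theorem measure_le_measure_thickening_add {E : Type*} [PseudoMetricSpace E]
    [SecondCountableTopology E] [MeasurableSpace E] [BorelSpace E] {p : ℝ} (hp : 0 < p)
    (μ ν : Measure E) {F : Set E} (hF : MeasurableSet F) {δ : ℝ} (hδ : 0 < δ) :
    μ F ≤ ν (Metric.thickening δ F) + wasserstein p μ ν ^ p / ENNReal.ofReal δ ^ p := by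
  have h0 : ENNReal.ofReal δ ^ p ≠ 0 := by
    simp [ENNReal.rpow_eq_zero_iff, hδ]
  have htop : ENNReal.ofReal δ ^ p ≠ ∞ := ENNReal.rpow_ne_top_of_nonneg hp.le ENNReal.ofReal_ne_top
  rw [← tsub_le_iff_left, ENNReal.le_div_iff_mul_le (Or.inl h0) (Or.inl htop),
    wasserstein_rpow hp]
  refine le_iInf₂ fun m hm => ?_
  rw [← ENNReal.le_div_iff_mul_le (Or.inl h0) (Or.inl htop), tsub_le_iff_left]
  calc μ F = m (Prod.fst ⁻¹' F) := by rw [← hm.1, Measure.map_apply measurable_fst hF]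
    _ ≤ m (Prod.snd ⁻¹' Metric.thickening δ F ∪
        {z | ENNReal.ofReal δ ^ p ≤ edist z.1 z.2 ^ p}) := by
        refine measure_mono fun z hz => ?_
        rcases lt_or_ge (edist z.2 z.1) (ENNReal.ofReal δ) with h | h
        · left
          rw [Set.mem_preimage, Metric.mem_thickening_iff]
          refine ⟨z.1, hz, ?_⟩
          rwa [edist_dist, ENNReal.ofReal_lt_ofReal_iff hδ] at h
        · right
          rw [edist_comm] at h
          exact ENNReal.rpow_le_rpow h hp.le
    _ ≤ m (Prod.snd ⁻¹' Metric.thickening δ F) +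
        m {z | ENNReal.ofReal δ ^ p ≤ edist z.1 z.2 ^ p} := measure_union_le _ _
    _ ≤ _ := by
        rw [← Measure.map_apply measurable_snd Metric.isOpen_thickening.measurableSet, hm.2]
        gcongr
        exact meas_ge_le_lintegral_div (by fun_prop) h0 htop

/-- Portmanteau: the thickening estimate bounds the limsup on closed sets, first along `l`, then as
δ → 0. -/
theorem tendsto_measure_of_tendsto_wasserstein {E : Type*} [PseudoMetricSpace E]
    [SecondCountableTopology E] [MeasurableSpace E] [BorelSpace E] {p : ℝ} (hp : 0 < p)
    {ι : Type*} {l : Filter ι} {μs : ι → Measure E} {μ : Measure E}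
    [∀ i, IsProbabilityMeasure (μs i)] [IsProbabilityMeasure μ]
    (h : Tendsto (fun i => wasserstein p (μs i) μ) l (𝓝 0)) {C : Set E} (hC : μ (frontier C) = 0) :
    Tendsto (fun i => μs i C) l (𝓝 (μ C)) := by
  rcases l.eq_or_neBot with rfl | hl
  · exact tendsto_bot
  refine tendsto_measure_of_null_frontier
    (limsup_measure_closed_le_iff_liminf_measure_open_ge.1 fun F hF => ?_) hC
  have hlim : Tendsto (fun δ => μ (Metric.thickening δ F)) (𝓝[>] 0) (𝓝 (μ F)) :=
    tendsto_measure_thickening_of_isClosed ⟨1, one_pos, measure_ne_top _ _⟩ hF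
  refine ge_of_tendsto hlim ?_
  filter_upwards [self_mem_nhdsWithin] with δ hδ
  rw [Set.mem_Ioi] at hδ
  have hδ0 : ENNReal.ofReal δ ^ p ≠ 0 := by
    simp [ENNReal.rpow_eq_zero_iff, hδ]
  have ht : Tendsto (fun i => μ (Metric.thickening δ F) +
      wasserstein p (μs i) μ ^ p / ENNReal.ofReal δ ^ p) l (𝓝 (μ (Metric.thickening δ F))) := by
    have h1 := (ENNReal.continuous_rpow_const (y := p)).tendsto 0 |>.comp h
    rw [ENNReal.zero_rpow_of_pos hp] at h1
    have h2 := (ENNReal.Tendsto.div_const h1 (Or.inr hδ0)).const_add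
      (μ (Metric.thickening δ F))
    simpa using h2
  rw [← ht.limsup_eq]
  exact limsup_le_limsup (Eventually.of_forall fun i =>
    measure_le_measure_thickening_add hp _ _ hF.measurableSet hδ)

theorem eLpNorm'_enorm_le_add_wasserstein {E : Type*} [NormedAddCommGroup E]
    [SecondCountableTopology E] [MeasurableSpace E] [BorelSpace E] {p : ℝ} (hp : 1 ≤ p)
    (μ ν : Measure E) : eLpNorm' (id : E → E) p μ ≤ eLpNorm' (id : E → E) p ν +
      wasserstein p μ ν := by
  have hp0 : 0 < p := by linarith
  -- Isolating the Wasserstein term leaves a lower bound to prove for every coupling, where it is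
  -- Minkowski's inequality; no optimal coupling is needed.
  rw [← tsub_le_iff_left, ← ENNReal.rpow_le_rpow_iff hp0, wasserstein_rpow hp0]
  refine le_iInf₂ fun m hm => ?_
  rw [← ENNReal.rpow_le_rpow_iff (z := 1 / p) (by positivity), ← ENNReal.rpow_mul,
    mul_one_div_cancel hp0.ne', ENNReal.rpow_one, tsub_le_iff_left]
  have h1 : eLpNorm' (id : E → E) p μ = eLpNorm' (fun z : E × E => z.1) p m := by
    rw [← hm.1, eLpNorm'_eq_lintegral_enorm, lintegral_map (by fun_prop) measurable_fst]; rfl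
  have h2 : eLpNorm' (id : E → E) p ν = eLpNorm' (fun z : E × E => ‖z.2‖ₑ) p m := by
    rw [← hm.2, eLpNorm'_eq_lintegral_enorm, lintegral_map (by fun_prop) measurable_snd]; rfl
  rw [h1, h2]
  refine (eLpNorm'_mono_enorm_ae (g := (fun z : E × E => ‖z.2‖ₑ) + fun z => edist z.1 z.2)
    hp0.le (ae_of_all _ fun z => ?_)).trans
    (eLpNorm'_add_le (by fun_prop) (by fun_prop) hp)
  rw [enorm_eq_self, Pi.add_apply, edist_eq_enorm_sub]
  calc ‖z.1‖ₑ = ‖z.2 + (z.1 - z.2)‖ₑ := by congr 1; abel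
    _ ≤ _ := enorm_add_le _ _

end Wasserstein

/-! ### Partitions into small continuity sets -/

theorem measure_frontier_sdiff_eq_zero {E : Type*} [TopologicalSpace E] [MeasurableSpace E]
    {μ : Measure E} {s t : Set E} (hs : μ (frontier s) = 0) (ht : μ (frontier t) = 0) :
    μ (frontier (s \ t)) = 0 := by
  refine measure_mono_null ?_ (measure_union_null hs ht)
  rw [Set.sdiff_eq]
  refine (frontier_inter_subset _ _).trans (Set.union_subset_union Set.inter_subset_left ?_)
  rw [frontier_compl]
  exact Set.inter_subset_right

/-- Take balls around a dense sequence, with radii in (ε/4, ε/2) chosen to have null boundary, and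
make them disjoint. Radii above ε/4 still cover the space, and those below ε/2 keep cell diameters
at most ε. -/
theorem exists_partition_null_frontier {E : Type*} [PseudoMetricSpace E]
    [SecondCountableTopology E] [MeasurableSpace E] [BorelSpace E] (μ : Measure E)
    [IsProbabilityMeasure μ] {ε : ℝ} (hε : 0 < ε) :
    ∃ C : ℕ → Set E, (∀ k, MeasurableSet (C k)) ∧ Pairwise (Function.onFun Disjoint C) ∧
      ⋃ k, C k = Set.univ ∧ (∀ k, μ (frontier (C k)) = 0) ∧
      ∀ k, ∀ x ∈ C k, ∀ y ∈ C k, edist x y ≤ ENNReal.ofReal ε := by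
  have : Nonempty E := μ.nonempty_of_neZero
  have hr : ∀ k, ∃ r ∈ Set.Ioo (ε / 4) (ε / 2),
      μ (frontier (Metric.thickening r {TopologicalSpace.denseSeq E k})) = 0 := fun k =>
    exists_null_frontier_thickening μ _ (by linarith)
  choose r hr hrμ using hr
  simp only [Metric.thickening_singleton] at hrμ
  refine ⟨disjointed fun k => Metric.ball (TopologicalSpace.denseSeq E k) (r k),
    MeasurableSet.disjointed fun k => measurableSet_ball, disjoint_disjointed _, ?_, ?_, ?_⟩
  · rw [iUnion_disjointed, Set.eq_univ_iff_forall]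
    intro x
    obtain ⟨k, hk⟩ := (TopologicalSpace.denseRange_denseSeq E).exists_dist_lt x
      (by positivity : 0 < ε / 4)
    exact Set.mem_iUnion.2 ⟨k, hk.trans (hr k).1⟩
  · intro k
    exact Nat.disjointedRec (p := fun s => μ (frontier s) = 0)
      (fun s i hs => measure_frontier_sdiff_eq_zero hs (hrμ i)) (hrμ k)
  · intro k x hx y hy
    have hx' := Metric.mem_ball.1 (disjointed_subset (fun k => Metric.ball (TopologicalSpace.denseSeq E k) (r k)) k hx)
    have hy' := Metric.mem_ball.1 (disjointed_subset (fun k => Metric.ball (TopologicalSpace.denseSeq E k) (r k)) k hy)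
    rw [edist_dist]
    refine ENNReal.ofReal_le_ofReal ?_
    have := dist_triangle_right x y (TopologicalSpace.denseSeq E k)
    linarith [(hr k).2]

/-! ### Empirical measures -/

section Empirical

variable {E : Type*} [MeasurableSpace E] {N : ℕ}

theorem isProbabilityMeasure_empiricalMeasure (hN : 0 < N) (y : Fin N → E) :
    IsProbabilityMeasure (empiricalMeasure y) := ⟨by
  simp only [empiricalMeasure, Measure.smul_apply, Measure.coe_finsetSum, Finset.sum_apply,
    measure_univ, Finset.sum_const, Finset.card_univ, Fintype.card_fin, nsmul_eq_mul, mul_one,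
    smul_eq_mul]
  exact ENNReal.inv_mul_cancel (by exact_mod_cast hN.ne') (ENNReal.natCast_ne_top N)⟩

theorem map_empiricalMeasure {F : Type*} [MeasurableSpace F] {f : E → F} (hf : Measurable f)
    (y : Fin N → E) : (empiricalMeasure y).map f = empiricalMeasure fun i => f (y i) := by
  simp only [empiricalMeasure, Measure.map_smul, Measure.map_finset_sum hf.aemeasurable,
    Measure.map_dirac' hf]

theorem lintegral_empiricalMeasure (y : Fin N → E) {f : E → ℝ≥0∞} (hf : Measurable f) :
    ∫⁻ x, f x ∂(empiricalMeasure y) = (N : ℝ≥0∞)⁻¹ * ∑ i, f (y i) := by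
  simp [empiricalMeasure, lintegral_smul_measure, lintegral_dirac' _ hf]

theorem natCast_inv_mul_ofReal_sum {g : Fin N → ℝ} (hg : ∀ i, 0 ≤ g i) :
    (N : ℝ≥0∞)⁻¹ * ∑ i, ENNReal.ofReal (g i) = ENNReal.ofReal ((∑ i, g i) / N) := by
  rcases Nat.eq_zero_or_pos N with rfl | hN
  · simp
  · rw [← ENNReal.ofReal_sum_of_nonneg fun i _ => hg i,
      ENNReal.ofReal_div_of_pos (by exact_mod_cast hN), ENNReal.ofReal_natCast, mul_comm,
      div_eq_mul_inv]

theorem empiricalMeasure_apply_eq_ofReal (y : Fin N → E) {S : Set E} (hS : MeasurableSet S) :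
    empiricalMeasure y S = ENNReal.ofReal ((∑ i, S.indicator (1 : E → ℝ) (y i)) / N) := by
  rw [← natCast_inv_mul_ofReal_sum fun i => (indicator_one_mem_Icc _ _).1,
    ← lintegral_indicator_one hS, lintegral_empiricalMeasure _ (measurable_one.indicator hS)]
  congr 1
  refine Finset.sum_congr rfl fun i _ => ?_
  by_cases h : y i ∈ S <;> simp [h]

end Empirical

theorem ae_exists_eventually_lintegral_empiricalMeasure_le {Ω E : Type*} [MeasurableSpace Ω]
    {P : Measure Ω} [NormedAddCommGroup E] [MeasurableSpace E] [BorelSpace E] {p : ℝ} (hp : 0 < p)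
    {Y : ℕ → Ω → E} (hY : MemLp (Y 0) (ENNReal.ofReal p) P)
    (hindep : iIndepFun Y P) (hident : ∀ i, IdentDistrib (Y i) (Y 0) P P) :
    ∃ B : ℝ≥0∞, B ≠ ∞ ∧ ∀ᵐ ω ∂P, ∀ᶠ N : ℕ in atTop,
      eLpNorm' (id : E → E) p (empiricalMeasure fun i : Fin N => Y i ω) ≤ B := by
  have hint : Integrable (fun ω => ‖Y 0 ω‖ ^ p) P := by
    have h := hY.integrable_norm_rpow (by simpa using hp) ENNReal.ofReal_ne_top
    rwa [ENNReal.toReal_ofReal hp.le] at h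
  have hm : Measurable fun x : E => ‖x‖ ^ p := by fun_prop
  have hslln := strong_law_ae_real (fun i ω => ‖Y i ω‖ ^ p) hint
    (fun i j hij => (hindep.indepFun hij).comp hm hm) (fun i => (hident i).comp hm)
  set c := ∫ ω, ‖Y 0 ω‖ ^ p ∂P
  -- The strong law gives limit c for the averages of ‖Y‖^p; the margin 1 yields a deterministic
  -- eventual bound.
  refine ⟨ENNReal.ofReal (c + 1) ^ (1 / p),
    ENNReal.rpow_ne_top_of_nonneg (by positivity) ENNReal.ofReal_ne_top, ?_⟩
  filter_upwards [hslln] with ω hω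
  filter_upwards [hω.eventually (gt_mem_nhds (lt_add_one c))] with N hN
  rw [eLpNorm'_eq_lintegral_enorm, lintegral_empiricalMeasure _ (by fun_prop)]
  refine ENNReal.rpow_le_rpow ?_ (by positivity)
  have : ∀ i : Fin N, ‖id (Y i ω)‖ₑ ^ p = ENNReal.ofReal (‖Y i ω‖ ^ p) := fun i => by
    rw [← ENNReal.ofReal_rpow_of_nonneg (norm_nonneg _) hp.le, ofReal_norm]
    rfl
  simp only [this]
  rw [natCast_inv_mul_ofReal_sum fun i => by positivity]
  refine ENNReal.ofReal_le_ofReal ?_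
  rw [Fin.sum_univ_eq_sum_range (fun i => ‖Y i ω‖ ^ p)]
  exact hN.le

/-! ### Couplings of empirical measures with their limit -/

theorem eLpNorm'_map_id {S E : Type*} [MeasurableSpace S] [NormedAddCommGroup E]
    [MeasurableSpace E] [OpensMeasurableSpace E] {p : ℝ} {μ : Measure S} {f : S → E}
    (hf : Measurable f) : eLpNorm' (id : E → E) p (μ.map f) = eLpNorm' f p μ := by
  rw [eLpNorm'_eq_lintegral_enorm, lintegral_map (by fun_prop) hf]
  rfl

/-- `empiricalMeasure id` is the uniform law on the indices. Moving all moments to this one space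
makes Minkowski available for tuples. -/
theorem eLpNorm'_id_empiricalMeasure {E : Type*} [NormedAddCommGroup E] [MeasurableSpace E]
    [OpensMeasurableSpace E] {p : ℝ} {N : ℕ} (y : Fin N → E) :
    eLpNorm' (id : E → E) p (empiricalMeasure y) =
      eLpNorm' y p (empiricalMeasure (id : Fin N → Fin N)) := by
  have hy : Measurable y := .of_discrete
  rw [← eLpNorm'_map_id hy, map_empiricalMeasure hy]
  rfl

theorem eLpNorm'_edist_le {S E : Type*} [MeasurableSpace S] [NormedAddCommGroup E]
    [MeasurableSpace E] [OpensMeasurableSpace E] {p : ℝ} (hp : 1 ≤ p) {μ : Measure S} {f g : S → E}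
    (hf : Measurable f) (hg : Measurable g) :
    eLpNorm' (fun s => edist (f s) (g s)) p μ ≤ eLpNorm' f p μ + eLpNorm' g p μ := by
  have h := eLpNorm'_add_le (μ := μ) (f := fun s => ‖f s‖ₑ) (g := fun s => ‖g s‖ₑ)
    hf.enorm.aestronglyMeasurable hg.enorm.aestronglyMeasurable hp
  refine (eLpNorm'_mono_enorm_ae (by linarith) (ae_of_all _ fun s => ?_)).trans h
  rw [enorm_eq_self, Pi.add_apply, enorm_eq_self, edist_eq_enorm_sub]
  exact enorm_sub_le

theorem eLpNorm'_prodMk_le {S E F : Type*} [MeasurableSpace S] [NormedAddCommGroup E]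
    [MeasurableSpace E] [OpensMeasurableSpace E] [NormedAddCommGroup F] [MeasurableSpace F]
    [OpensMeasurableSpace F] {p : ℝ} (hp : 1 ≤ p) {μ : Measure S} {f : S → E} {g : S → F}
    (hf : Measurable f) (hg : Measurable g) :
    eLpNorm' (fun s => (f s, g s)) p μ ≤ eLpNorm' f p μ + eLpNorm' g p μ := by
  have h := eLpNorm'_add_le (μ := μ) (f := fun s => ‖f s‖ₑ) (g := fun s => ‖g s‖ₑ)
    hf.enorm.aestronglyMeasurable hg.enorm.aestronglyMeasurable hp
  refine (eLpNorm'_mono_enorm_ae (by linarith) (ae_of_all _ fun s => ?_)).trans h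
  rw [Pi.add_apply, enorm_eq_self, ← edist_zero_right, ← edist_zero_right (f s),
    ← edist_zero_right (g s)]
  exact max_le le_self_add le_add_self

theorem MemLp.eLpNorm'_ne_top {S E : Type*} [MeasurableSpace S] [NormedAddCommGroup E] {p : ℝ}
    (hp : 0 < p) {μ : Measure S} {f : S → E} (hf : MemLp f (ENNReal.ofReal p) μ) :
    eLpNorm' f p μ ≠ ∞ := by
  have h := hf.2
  rw [eLpNorm_eq_eLpNorm' (by simpa using hp) ENNReal.ofReal_ne_top, ENNReal.toReal_ofReal hp.le]
    at h
  exact h.ne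

theorem eLpNorm'_empiricalMeasure_ne_top {E F : Type*} [MeasurableSpace E] [NormedAddCommGroup F]
    [MeasurableSpace F] [OpensMeasurableSpace F] {N : ℕ} (hN : 0 < N) {p : ℝ} (hp : 0 < p)
    (y : Fin N → E) {f : E → F} (hf : Measurable f) :
    eLpNorm' f p (empiricalMeasure y) ≠ ∞ := by
  rw [eLpNorm'_eq_lintegral_enorm, lintegral_empiricalMeasure _ (by fun_prop)]
  refine ENNReal.rpow_ne_top_of_nonneg (by positivity) (ENNReal.mul_ne_top ?_ ?_)
  · exact ENNReal.inv_ne_top.2 (by exact_mod_cast hN.ne')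
  · exact ENNReal.sum_ne_top.2 fun i _ => ENNReal.rpow_ne_top_of_nonneg hp.le enorm_ne_top

theorem exists_rpow_mul_le {q : ℝ} (hq : 0 < q) {B κ : ℝ≥0∞} (hB : B ≠ ∞) (hκ : 0 < κ) :
    ∃ M : ℝ≥0∞, 0 < M ∧ M ≠ ∞ ∧ M ^ (-q) * B ≤ κ := by
  have h1 : Tendsto (fun x : ℝ => ENNReal.ofReal (x ^ (-q)) * B) atTop (𝓝 0) := by
    have h := ENNReal.Tendsto.mul_const (ENNReal.tendsto_ofReal (tendsto_rpow_neg_atTop hq))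
      (Or.inr hB)
    simpa using h
  obtain ⟨x, hx, hx0⟩ := ((h1.eventually (ge_mem_nhds hκ)).and (eventually_gt_atTop 0)).exists
  refine ⟨ENNReal.ofReal x, by simpa using hx0, ENNReal.ofReal_ne_top, ?_⟩
  rwa [ENNReal.ofReal_rpow_of_pos hx0]

/-- If the empirical measures converge on the cells of arbitrarily fine partitions and have
bounded `p'`-th moments, then they can be coupled with the limit at a small `L^p` distance. -/
theorem eventually_exists_coupling {E Ω' ι : Type*} [NormedAddCommGroup E]
    [SecondCountableTopology E] [MeasurableSpace E] [BorelSpace E] [MeasurableSpace Ω']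
    [Countable ι] {P' : Measure Ω'} [IsProbabilityMeasure P'] {p p' : ℝ} (hp : 1 ≤ p)
    (hpp' : p < p') {ybar : Ω' → E} (hybar : Measurable ybar) {y : (N : ℕ) → Fin N → E}
    {D : ℕ → ι → Set E} (hD : ∀ k j, MeasurableSet (D k j))
    (hDd : ∀ k, Pairwise (Function.onFun Disjoint (D k))) (hDu : ∀ k, ⋃ j, D k j = Set.univ)
    (hDε : ∀ k j, ∀ a ∈ D k j, ∀ b ∈ D k j, edist a b ≤ ENNReal.ofReal (1 / ((k : ℝ) + 1)))
    (hconv : ∀ k j, Tendsto (fun N => empiricalMeasure (y N) (D k j)) atTop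
      (𝓝 (P'.map ybar (D k j))))
    {B : ℝ≥0∞} (hB : B ≠ ∞)
    (hyB : ∀ᶠ N in atTop, eLpNorm' (id : E → E) p' (empiricalMeasure (y N)) ≤ B)
    (hybarB : eLpNorm' ybar p' P' ≤ B) {η : ℝ≥0∞} (hη : 0 < η) :
    ∀ᶠ N in atTop, ∃ m : Measure (Fin N × Ω'),
      m.map Prod.fst = empiricalMeasure (id : Fin N → Fin N) ∧ m.map Prod.snd = P' ∧
      eLpNorm' (fun z => edist (y N z.1) (ybar z.2)) p m ≤ η := by
  have hp0 : 0 < p := by linarith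
  have hp0' : 0 < p' := by linarith
  -- One third each for the cell diameter (via k), the mass δ of pairs not in a common cell (cost at
  -- most M^p δ), and the tail beyond M.
  set κ : ℝ≥0∞ := η ^ p / 3 with hκ
  have hκ0 : 0 < κ := ENNReal.div_pos (by simp [ENNReal.rpow_eq_zero_iff, hη.ne', hp0.not_gt])
    (by norm_num)
  have hB2 : (B + B) ^ p' ≠ ∞ :=
    ENNReal.rpow_ne_top_of_nonneg hp0'.le (ENNReal.add_ne_top.2 ⟨hB, hB⟩)
  obtain ⟨M, hM0, hMtop, hM⟩ := exists_rpow_mul_le (sub_pos.2 hpp') hB2 hκ0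
  have hMptop : M ^ p ≠ ∞ := ENNReal.rpow_ne_top_of_nonneg hp0.le hMtop
  set δ : ℝ≥0∞ := κ / M ^ p with hδ
  have hδ0 : δ ≠ 0 := (ENNReal.div_pos hκ0.ne' hMptop).ne'
  obtain ⟨k, hk⟩ : ∃ k : ℕ, ENNReal.ofReal (1 / ((k : ℝ) + 1)) ^ p ≤ κ := by
    have h1 := (ENNReal.continuous_rpow_const (y := p)).tendsto 0
    rw [ENNReal.zero_rpow_of_pos hp0] at h1
    have h2 := ENNReal.tendsto_ofReal (tendsto_one_div_add_atTop_nhds_zero_nat (𝕜 := ℝ))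
    rw [ENNReal.ofReal_zero] at h2
    exact ((h1.comp h2).eventually (ge_mem_nhds hκ0)).exists
  have := Measure.isProbabilityMeasure_map (μ := P') hybar.aemeasurable
  obtain ⟨s, hs⟩ : ∃ s : Finset ι, 1 - δ < ∑ j ∈ s, P'.map ybar (D k j) := by
    have h1 : ∑' j, P'.map ybar (D k j) = 1 := by
      rw [← measure_iUnion (hDd k) (hD k), hDu, measure_univ]
    rw [← lt_iSup_iff, ← ENNReal.tsum_eq_iSup_sum, h1]
    exact ENNReal.sub_lt_self ENNReal.one_ne_top one_ne_zero hδ0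
  have hlim : Tendsto (fun N => ∑ j ∈ s, min (empiricalMeasure (y N) (D k j))
      (P'.map ybar (D k j))) atTop (𝓝 (∑ j ∈ s, P'.map ybar (D k j))) := by
    have h := tendsto_finsetSum s fun j _ => (hconv k j).min
      (tendsto_const_nhds (x := P'.map ybar (D k j)))
    simpa only [min_self] using h
  filter_upwards [hlim.eventually (lt_mem_nhds hs), hyB, eventually_gt_atTop 0] with N hN hNB hN0
  have := isProbabilityMeasure_empiricalMeasure hN0 (id : Fin N → Fin N)
  have hyN : Measurable (y N) := .of_discrete
  have hmapy : (empiricalMeasure (id : Fin N → Fin N)).map (y N) = empiricalMeasure (y N) :=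
    map_empiricalMeasure hyN _
  -- The cells are pulled back so that the coupling lives on `Fin N × Ω'` rather than on E × E; the
  -- solutions can then be carried along with the inputs.
  obtain ⟨m, hm1, hm2, hm⟩ := exists_coupling_of_partition
    (empiricalMeasure (id : Fin N → Fin N)) P' s (A := fun j => y N ⁻¹' D k j)
    (B := fun j => ybar ⁻¹' D k j) (fun j => hyN (hD k j)) (fun j => hybar (hD k j))
    (fun i j hij => (hDd k hij).preimage _) (fun i j hij => (hDd k hij).preimage _)
  refine ⟨m, hm1, hm2, ?_⟩
  have hmprob : IsProbabilityMeasure m := ⟨by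
    rw [← Set.preimage_univ (f := Prod.fst), ← Measure.map_apply measurable_fst .univ, hm1,
      measure_univ]⟩
  have hbad : m {z | ENNReal.ofReal (1 / ((k : ℝ) + 1)) < edist (y N z.1) (ybar z.2)} ≤ δ := by
    calc _ ≤ m (⋃ j ∈ s, (y N ⁻¹' D k j) ×ˢ (ybar ⁻¹' D k j))ᶜ := by
          refine measure_mono fun z hz hz' => ?_
          simp only [Set.mem_iUnion] at hz'
          obtain ⟨j, -, hj1, hj2⟩ := hz'
          exact absurd (hDε k j _ hj1 _ hj2) (not_le.2 hz)
      _ ≤ 1 - ∑ j ∈ s, min (empiricalMeasure (y N) (D k j)) (P'.map ybar (D k j)) := by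
          refine hm.trans (le_of_eq ?_)
          congr 1
          refine Finset.sum_congr rfl fun j _ => ?_
          rw [← hmapy, Measure.map_apply hyN (hD k j), Measure.map_apply hybar (hD k j)]
      _ ≤ δ := by
          rw [tsub_le_iff_left, ← tsub_le_iff_right]
          exact hN.le
  have hmom : ∫⁻ z, edist (y N z.1) (ybar z.2) ^ p' ∂m ≤ (B + B) ^ p' := by
    have h1 : eLpNorm' (fun z : Fin N × Ω' => edist (y N z.1) (ybar z.2)) p' m ≤ B + B := by
      refine (eLpNorm'_edist_le (by linarith) (hyN.comp measurable_fst)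
        (hybar.comp measurable_snd)).trans (add_le_add ?_ ?_)
      · rw [← eLpNorm'_map_id (hyN.comp measurable_fst), ← Measure.map_map hyN measurable_fst, hm1,
          hmapy]
        exact hNB
      · rw [← eLpNorm'_map_id (hybar.comp measurable_snd), ← Measure.map_map hybar measurable_snd,
          hm2, eLpNorm'_map_id hybar]
        exact hybarB
    have h2 := ENNReal.rpow_le_rpow h1 hp0'.le
    rwa [eLpNorm'_eq_lintegral_enorm, ← ENNReal.rpow_mul, one_div_mul_cancel hp0'.ne',
      ENNReal.rpow_one] at h2
  have hmeas : Measurable fun z : Fin N × Ω' => edist (y N z.1) (ybar z.2) := by fun_prop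
  have hfinal : ∫⁻ z, edist (y N z.1) (ybar z.2) ^ p ∂m ≤ η ^ p := by
    refine (lintegral_rpow_le_of_measure_lt hp0 hpp' hmeas
      (ENNReal.ofReal (1 / ((k : ℝ) + 1))) hM0 hMtop).trans ?_
    calc _ ≤ κ + M ^ p * δ + M ^ (-(p' - p)) * (B + B) ^ p' := by
          rw [neg_sub]
          gcongr
      _ ≤ κ + κ + κ := by
          gcongr
          exact ENNReal.mul_div_le
      _ = η ^ p := by
          rw [← ENNReal.add_thirds (η ^ p)]
  rw [eLpNorm'_eq_lintegral_enorm, one_div, ENNReal.rpow_inv_le_iff hp0]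
  exact hfinal

/-- Cells are products of cells in the three factors. Countably many of them give a single null set,
and the p'-moments are bounded by the strong law for X and Y and by Wasserstein convergence for Z.
-/
theorem ae_eventually_exists_coupling {Ω Ω' E₁ E₂ E₃ : Type*} [MeasurableSpace Ω]
    [MeasurableSpace Ω'] {P : Measure Ω} [IsProbabilityMeasure P] {P' : Measure Ω'}
    [IsProbabilityMeasure P']
    [NormedAddCommGroup E₁] [SecondCountableTopology E₁] [MeasurableSpace E₁] [BorelSpace E₁]
    [NormedAddCommGroup E₂] [SecondCountableTopology E₂] [MeasurableSpace E₂] [BorelSpace E₂]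
    [NormedAddCommGroup E₃] [SecondCountableTopology E₃] [MeasurableSpace E₃] [BorelSpace E₃]
    {p p' : ℝ} (hp : 1 ≤ p) (hpp' : p < p')
    {X : ℕ → Ω → E₁} {Y : ℕ → Ω → E₂} {Z : (N : ℕ) → Fin N → Ω → E₃}
    (hX : ∀ i, Measurable (X i)) (hY : ∀ i, Measurable (Y i)) (hZ : ∀ N i, Measurable (Z N i))
    (hX_Lp : MemLp (X 0) (ENNReal.ofReal p') P) (hY_Lp : MemLp (Y 0) (ENNReal.ofReal p') P)
    (hX_indep : iIndepFun X P) (hX_ident : ∀ i, IdentDistrib (X i) (X 0) P P)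
    (hY_indep : iIndepFun Y P) (hY_ident : ∀ i, IdentDistrib (Y i) (Y 0) P P)
    (hXY : IndepFun (fun ω i => X i ω) (fun ω i => Y i ω) P)
    (hZXY : ∀ N, IndepFun (fun ω i => Z N i ω) (fun ω => ((fun i => X i ω), (fun i => Y i ω))) P)
    {x : Ω' → E₁} {y : Ω' → E₂} {z : Ω' → E₃} (hx : Measurable x) (hy : Measurable y)
    (hz : Measurable z) (hxX : IdentDistrib x (X 0) P' P) (hyY : IdentDistrib y (Y 0) P' P)
    (hz_Lp : eLpNorm' z p' P' ≠ ∞) (hxy : IndepFun x y P')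
    (hzxy : IndepFun z (fun ω => (x ω, y ω)) P')
    (hconv : ∀ᵐ ω ∂P, Tendsto (fun N : ℕ =>
      wasserstein p' (empiricalMeasure fun i : Fin N => Z N i ω) (P'.map z)) atTop (𝓝 0)) :
    ∀ᵐ ω ∂P, ∀ η : ℝ≥0∞, 0 < η → ∀ᶠ N in atTop, ∃ m : Measure (Fin N × Ω'),
      m.map Prod.fst = empiricalMeasure (id : Fin N → Fin N) ∧ m.map Prod.snd = P' ∧
      eLpNorm' (fun s => edist (X s.1 ω, Y s.1 ω, Z N s.1 ω) (x s.2, y s.2, z s.2)) p m ≤ η := by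
  have hp0' : 0 < p' := by linarith
  have hxm := Measure.isProbabilityMeasure_map (μ := P') hx.aemeasurable
  have hym := Measure.isProbabilityMeasure_map (μ := P') hy.aemeasurable
  have hzm := Measure.isProbabilityMeasure_map (μ := P') hz.aemeasurable
  have hkpos : ∀ k : ℕ, 0 < 1 / ((k : ℝ) + 1) := fun k => by positivity
  -- Null boundaries matter only for the cells of z: for x and y the law of large numbers handles
  -- every measurable set.
  choose A hA hAd hAu _ hAε using fun k : ℕ => exists_partition_null_frontier (P'.map x) (hkpos k)
  choose B hB hBd hBu _ hBε using fun k : ℕ => exists_partition_null_frontier (P'.map y) (hkpos k)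
  choose C hC hCd hCu hC0 hCε using
    fun k : ℕ => exists_partition_null_frontier (P'.map z) (hkpos k)
  have hCconv : ∀ k c, ∀ᵐ ω ∂P, Tendsto (fun N : ℕ =>
      (∑ i : Fin N, (C k c).indicator (1 : E₃ → ℝ) (Z N i ω)) / N) atTop
      (𝓝 ((P'.map z).real (C k c))) := fun k c => by
    filter_upwards [hconv] with ω hω
    -- Shift the index, since the empirical measure of zero points is not a probability measure.
    rw [← tendsto_add_atTop_iff_nat 1] at hω ⊢
    have := fun N : ℕ => isProbabilityMeasure_empiricalMeasure (Nat.succ_pos N)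
      (fun i : Fin (N + 1) => Z (N + 1) i ω)
    have h := tendsto_measure_of_tendsto_wasserstein hp0' hω (hC0 k c)
    have h' := (ENNReal.tendsto_toReal (measure_ne_top _ _)).comp h
    refine h'.congr fun N => ?_
    rw [Function.comp_apply, empiricalMeasure_apply_eq_ofReal _ (hC k c), ENNReal.toReal_ofReal]
    exact div_nonneg (Finset.sum_nonneg fun i _ => (indicator_one_mem_Icc _ _).1) (by positivity)
  have hall : ∀ᵐ ω ∂P, ∀ k a b c, Tendsto (fun N : ℕ => (∑ i : Fin N,
      (A k a).indicator (1 : E₁ → ℝ) (X i ω) * ((B k b).indicator (1 : E₂ → ℝ) (Y i ω) *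
        (C k c).indicator (1 : E₃ → ℝ) (Z N i ω))) / N) atTop
      (𝓝 (P.real (X 0 ⁻¹' A k a) * (P.real (Y 0 ⁻¹' B k b) * (P'.map z).real (C k c)))) := by
    simp only [ae_all_iff]
    exact fun k a b c => ae_tendsto_average_indicator_mul hX hY hZ hX_indep hX_ident hY_indep
      hY_ident hXY hZXY (hA k a) (hB k b) (hC k c) (hCconv k c)
  obtain ⟨BX, hBX, hXmom⟩ :=
    ae_exists_eventually_lintegral_empiricalMeasure_le hp0' hX_Lp hX_indep hX_ident
  obtain ⟨BY, hBY, hYmom⟩ :=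
    ae_exists_eventually_lintegral_empiricalMeasure_le hp0' hY_Lp hY_indep hY_ident
  have hxLp : eLpNorm' x p' P' ≠ ∞ := MemLp.eLpNorm'_ne_top hp0' (hxX.memLp_iff.2 hX_Lp)
  have hyLp : eLpNorm' y p' P' ≠ ∞ := MemLp.eLpNorm'_ne_top hp0' (hyY.memLp_iff.2 hY_Lp)
  have hbar : eLpNorm' (fun ω => (x ω, y ω, z ω)) p' P' ≠ ∞ :=
    ne_top_of_le_ne_top (ENNReal.add_ne_top.2 ⟨hxLp, ENNReal.add_ne_top.2 ⟨hyLp, hz_Lp⟩⟩)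
      ((eLpNorm'_prodMk_le (by linarith) hx (hy.prodMk hz)).trans
        (add_le_add le_rfl (eLpNorm'_prodMk_le (by linarith) hy hz)))
  filter_upwards [hall, hXmom, hYmom, hconv] with ω hall hXmom hYmom hω η hη
  set BZ := eLpNorm' z p' P' + 1 with hBZ
  have hZmom : ∀ᶠ N in atTop,
      eLpNorm' (id : E₃ → E₃) p' (empiricalMeasure fun i : Fin N => Z N i ω) ≤ BZ := by
    filter_upwards [hω.eventually (ge_mem_nhds one_pos)] with N hN
    refine (eLpNorm'_enorm_le_add_wasserstein (by linarith) _ (P'.map z)).trans ?_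
    rw [eLpNorm'_map_id hz]
    exact add_le_add le_rfl hN
  refine eventually_exists_coupling (B := max (BX + (BY + BZ))
      (eLpNorm' (fun ω => (x ω, y ω, z ω)) p' P')) hp hpp' (hx.prodMk (hy.prodMk hz))
    (y := fun N i => (X i ω, Y i ω, Z N i ω))
    (D := fun k (j : ℕ × ℕ × ℕ) => A k j.1 ×ˢ (B k j.2.1 ×ˢ C k j.2.2))
    (fun k j => (hA k _).prod ((hB k _).prod (hC k _))) ?_ ?_ ?_ ?_ ?_ ?_ (le_max_right _ _) hη
  · rintro k ⟨a, b, c⟩ ⟨a', b', c'⟩ hne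
    simp only [Function.onFun, Set.disjoint_prod]
    by_cases h1 : a = a'
    · by_cases h2 : b = b'
      · exact Or.inr (Or.inr (hCd k fun h3 => hne (by rw [h1, h2, h3])))
      · exact Or.inr (Or.inl (hBd k h2))
    · exact Or.inl (hAd k h1)
  · refine fun k => Set.eq_univ_iff_forall.2 fun ⟨u, v, w⟩ => ?_
    obtain ⟨a, ha⟩ := Set.mem_iUnion.1 ((hAu k).symm ▸ Set.mem_univ u)
    obtain ⟨b, hb⟩ := Set.mem_iUnion.1 ((hBu k).symm ▸ Set.mem_univ v)
    obtain ⟨c, hc⟩ := Set.mem_iUnion.1 ((hCu k).symm ▸ Set.mem_univ w)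
    exact Set.mem_iUnion.2 ⟨(a, b, c), ha, hb, hc⟩
  · rintro k j ⟨u, v, w⟩ ⟨hu, hv, hw⟩ ⟨u', v', w'⟩ ⟨hu', hv', hw'⟩
    exact max_le (hAε k _ _ hu _ hu') (max_le (hBε k _ _ hv _ hv') (hCε k _ _ hw _ hw'))
  · rintro k ⟨a, b, c⟩
    have hmeas : MeasurableSet (A k a ×ˢ (B k b ×ˢ C k c)) :=
      (hA k _).prod ((hB k _).prod (hC k _))
    have hlaw : P'.map (fun ω => (x ω, y ω, z ω)) (A k a ×ˢ (B k b ×ˢ C k c)) = ENNReal.ofReal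
        (P.real (X 0 ⁻¹' A k a) * (P.real (Y 0 ⁻¹' B k b) * (P'.map z).real (C k c))) := by
      have hi := IndepFun.indepFun_prodMk_of_indepFun_prodMk hx hy hz hxy hzxy
      have hyz : IndepFun y z P' := (hzxy.comp (φ := id) measurable_id measurable_snd).symm
      rw [hi.map_prod_eq_prod_map_map hx.aemeasurable (hy.prodMk hz).aemeasurable,
        hyz.map_prod_eq_prod_map_map hy.aemeasurable hz.aemeasurable, Measure.prod_prod,
        Measure.prod_prod, hxX.map_eq, hyY.map_eq, Measure.map_apply (hX 0) (hA k a),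
        Measure.map_apply (hY 0) (hB k b), ENNReal.ofReal_mul measureReal_nonneg,
        ENNReal.ofReal_mul measureReal_nonneg, ofReal_measureReal, ofReal_measureReal,
        ofReal_measureReal]
    rw [hlaw]
    refine (ENNReal.tendsto_ofReal (hall k a b c)).congr fun N => ?_
    rw [empiricalMeasure_apply_eq_ofReal _ hmeas]
    congr 2
    refine Finset.sum_congr rfl fun i _ => ?_
    by_cases h1 : X i ω ∈ A k a <;> by_cases h2 : Y i ω ∈ B k b <;>
      by_cases h3 : Z N i ω ∈ C k c <;> simp [h1, h2, h3]
  · exact max_ne_top (ENNReal.add_ne_top.2 ⟨hBX, ENNReal.add_ne_top.2 ⟨hBY,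
      ENNReal.add_ne_top.2 ⟨hz_Lp, ENNReal.one_ne_top⟩⟩⟩) hbar
  · filter_upwards [hXmom, hYmom, hZmom] with N h1 h2 h3
    refine le_trans ?_ (le_max_left _ _)
    rw [eLpNorm'_id_empiricalMeasure] at h1 h2 h3 ⊢
    refine (eLpNorm'_prodMk_le (by linarith) .of_discrete .of_discrete).trans (add_le_add h1 ?_)
    exact (eLpNorm'_prodMk_le (by linarith) .of_discrete .of_discrete).trans (add_le_add h2 h3)

/-! ### Convergence of the particle system -/

theorem SolvesMcKeanVlasov.congr {T p : ℝ} {d n : ℕ} {b : Drift T p d n} {Ω : Type*}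
    [MeasurableSpace Ω] {P : Measure Ω} {ζ ζ' : Ω → Euc d} {W W' : Ω → PathSpace T (Euc d)}
    {R : Ω → PathSpace T (Euc n)} {X : Ω → PathSpace T (Euc d)}
    (h : SolvesMcKeanVlasov b P ζ W R X) (hζ : ζ =ᵐ[P] ζ') (hW : W =ᵐ[P] W') :
    SolvesMcKeanVlasov b P ζ' W' R X := by
  obtain ⟨hX, μ, hμ, hsol⟩ := h
  refine ⟨hX, μ, hμ, ?_⟩
  filter_upwards [hsol, hζ, hW] with ω h1 h2 h3
  rwa [← h2, ← h3]

/-- A Wasserstein limit of empirical measures has a finite moment. -/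
theorem eLpNorm'_ne_top_of_tendsto_wasserstein {Ω' E : Type*} [MeasurableSpace Ω']
    [NormedAddCommGroup E] [SecondCountableTopology E] [MeasurableSpace E] [BorelSpace E]
    {P' : Measure Ω'} {p : ℝ} (hp : 1 ≤ p) {z : Ω' → E} (hz : Measurable z)
    {y : (N : ℕ) → Fin N → E}
    (h : Tendsto (fun N => wasserstein p (empiricalMeasure (y N)) (P'.map z)) atTop (𝓝 0)) :
    eLpNorm' z p P' ≠ ∞ := by
  obtain ⟨N, hN, hN0⟩ := ((h.eventually (ge_mem_nhds one_pos)).and (eventually_gt_atTop 0)).exists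
  rw [← eLpNorm'_map_id hz]
  refine ne_top_of_le_ne_top ?_ (eLpNorm'_enorm_le_add_wasserstein hp _ (empiricalMeasure (y N)))
  refine ENNReal.add_ne_top.2 ⟨eLpNorm'_empiricalMeasure_ne_top hN0 (by linarith) _ measurable_id,
    ?_⟩
  rw [wasserstein_comm]
  exact ne_top_of_le_ne_top ENNReal.one_ne_top hN

theorem corollary3p6
    (T p p' : ℝ) (hT : 0 < T) (hp : 1 ≤ p) (hpp' : p < p') (d n : ℕ)
    -- the drift: Borel, and Lipschitz in the space and measure variables
    (b : Drift T p d n)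
    (hb_meas : Measurable fun q : Set.Icc (0 : ℝ) T × EucPair d n ×
      FiniteMomentMeasure p (EucPair d n) => b q.1 q.2.1 q.2.2)
    (K : ℝ≥0)
    (hb_lip : ∀ (t : Set.Icc (0 : ℝ) T) (x x' : EucPair d n)
      (μ μ' : FiniteMomentMeasure p (EucPair d n)),
      ‖b t x μ - b t x' μ'‖ₑ ^ p ≤
        K * (‖x - x'‖ₑ ^ p + wasserstein p μ.toMeasure μ'.toMeasure ^ p))
    -- the inputs of the particles
    {Ω : Type*} [MeasurableSpace Ω] (P : Measure Ω) [IsProbabilityMeasure P]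
    (ζ : ℕ → Ω → Euc d) (W : ℕ → Ω → PathSpace T (Euc d))
    (R : (N : ℕ) → Fin N → Ω → PathSpace T (Euc n))
    (hζ_meas : ∀ i, Measurable (ζ i)) (hW_meas : ∀ i, Measurable (W i))
    (hR_meas : ∀ N i, Measurable (R N i))
    (hζ_Lp : ∀ i, MemLp (ζ i) (ENNReal.ofReal p') P)
    (hW_Lp : ∀ i, MemLp (W i) (ENNReal.ofReal p') P)
    (hR_Lp : ∀ N i, MemLp (R N i) (ENNReal.ofReal p') P)
    -- `ζ` and `W` are i.i.d. families, independent of each other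
    (hζ_indep : iIndepFun ζ P) (hζ_ident : ∀ i, IdentDistrib (ζ i) (ζ 0) P P)
    (hW_indep : iIndepFun W P) (hW_ident : ∀ i, IdentDistrib (W i) (W 0) P P)
    (hζW_indep : IndepFun (fun ω i => ζ i ω) (fun ω i => W i ω) P)
    -- for each `N` the `R^{i,N}` are independent, and independent of `(ζ, W)`
    (hR_indep : ∀ N, iIndepFun (R N) P)
    (hR_indep_others : ∀ N, IndepFun (fun ω i => R N i ω)
      (fun ω => ((fun i => ζ i ω), (fun i => W i ω))) P)
    -- the inputs of the limit equation
    {Ω' : Type*} [MeasurableSpace Ω'] (P' : Measure Ω') [IsProbabilityMeasure P']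
    (ζbar : Ω' → Euc d) (Wbar : Ω' → PathSpace T (Euc d)) (Rbar : Ω' → PathSpace T (Euc n))
    (hRbar_meas : Measurable Rbar)
    (hζbar : IdentDistrib ζbar (ζ 0) P' P) (hWbar : IdentDistrib Wbar (W 0) P' P)
    (hbar_indep : IndepFun ζbar Wbar P')
    (hbar_indep' : IndepFun Rbar (fun ω => (ζbar ω, Wbar ω)) P')
    -- the solutions of the particle systems and of the limit equation
    (X : (N : ℕ) → Fin N → Ω → PathSpace T (Euc d))
    (hX_meas : ∀ N i, Measurable (X N i))
    (hX : ∀ N, 0 < N → ∀ᵐ ω ∂P, SolvesParticleSystem b (fun i : Fin N => ζ i ω)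
      (fun i => W i ω) (fun i => R N i ω) (fun i => X N i ω))
    (Xbar : Ω' → PathSpace T (Euc d))
    (hXbar : SolvesMcKeanVlasov b P' ζbar Wbar Rbar Xbar)
    -- convergence of the heterogeneous part
    (hconv : ∀ᵐ ω ∂P, Tendsto (fun N : ℕ =>
      wasserstein p' (empiricalMeasure fun i : Fin N => R N i ω) (P'.map Rbar)) atTop (𝓝 0)) :
    ∀ᵐ ω ∂P, Tendsto (fun N : ℕ =>
      wasserstein p (empiricalMeasure fun i : Fin N => pairPath (X N i ω) (R N i ω))
        (P'.map fun ω' => pairPath (Xbar ω') (Rbar ω'))) atTop (𝓝 0) := by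
  have hp0 : 0 < p := by linarith
  have hp0' : 0 < p' := by linarith
  -- Identity in distribution gives only a.e. measurability, so measurable versions replace the
  -- limit inputs.
  obtain ⟨ζ', hζ'm, hζζ'⟩ := hζbar.aemeasurable_fst
  obtain ⟨W', hW'm, hWW'⟩ := hWbar.aemeasurable_fst
  have hζ'id : IdentDistrib ζ' (ζ 0) P' P :=
    ⟨hζ'm.aemeasurable, (hζ_meas 0).aemeasurable, by rw [← Measure.map_congr hζζ', hζbar.map_eq]⟩
  have hW'id : IdentDistrib W' (W 0) P' P :=
    ⟨hW'm.aemeasurable, (hW_meas 0).aemeasurable, by rw [← Measure.map_congr hWW', hWbar.map_eq]⟩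
  have hindep : IndepFun ζ' W' P' := hbar_indep.congr hζζ' hWW'
  have hindep' : IndepFun Rbar (fun ω => (ζ' ω, W' ω)) P' :=
    hbar_indep'.congr .rfl (hζζ'.prodMk hWW')
  have hMV := hXbar.congr hζζ' hWW'
  -- Integrability of Rbar is not assumed; it is inherited from an empirical measure at finite
  -- Wasserstein distance.
  have hR_Lp' : eLpNorm' Rbar p' P' ≠ ∞ := by
    obtain ⟨ω, hω⟩ := hconv.exists
    exact eLpNorm'_ne_top_of_tendsto_wasserstein (by linarith) hRbar_meas hω
  have hRbar_Lp : MemLp Rbar (ENNReal.ofReal p') P' := by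
    refine ⟨hRbar_meas.aestronglyMeasurable, ?_⟩
    rw [eLpNorm_eq_eLpNorm' (by simpa using hp0') ENNReal.ofReal_ne_top,
      ENNReal.toReal_ofReal hp0'.le]
    exact hR_Lp'.lt_top
  have hXbar_Lp : eLpNorm' Xbar p P' ≠ ∞ :=
    MemLp.eLpNorm'_ne_top hp0 ((memLp_of_solvesMcKeanVlasov hT hp hb_lip hMV
      (hζ'id.memLp_iff.2 (hζ_Lp 0)) (hW'id.memLp_iff.2 (hW_Lp 0)) hRbar_Lp).mono_exponent
      (ENNReal.ofReal_le_ofReal hpp'.le))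
  have hcoup := ae_eventually_exists_coupling hp hpp' hζ_meas hW_meas hR_meas (hζ_Lp 0) (hW_Lp 0)
    hζ_indep hζ_ident hW_indep hW_ident hζW_indep hR_indep_others hζ'm hW'm hRbar_meas hζ'id hW'id
    hR_Lp' hindep hindep' hconv
  obtain ⟨C, hC, hstab⟩ := exists_wasserstein_map_pairPath_le hT hp hb_lip
  obtain ⟨hXbar_meas, ν, hν, hνsol⟩ := hMV
  have hX' : ∀ᵐ ω ∂P, ∀ N, 0 < N → SolvesParticleSystem b (fun i : Fin N => ζ i ω)
      (fun i => W i ω) (fun i => R N i ω) (fun i => X N i ω) := by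
    simp only [ae_all_iff]
    exact hX
  filter_upwards [hcoup, hX'] with ω hω hsol
  rw [ENNReal.tendsto_nhds_zero]
  intro ε hε
  have hC3 : ENNReal.ofReal C * 3 ≠ ∞ := ENNReal.mul_ne_top ENNReal.ofReal_ne_top (by norm_num)
  -- The factor 3 arises because the stability bound adds three distances, whereas the coupling
  -- controls their maximum.
  filter_upwards [hω (ε / (ENNReal.ofReal C * 3)) (ENNReal.div_pos hε.ne' hC3),
    eventually_gt_atTop 0] with N hN hN0
  obtain ⟨m, hm1, hm2, hm⟩ := hN
  obtain ⟨μ, hμ, hμsol⟩ := hsol N hN0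
  have := isProbabilityMeasure_empiricalMeasure hN0 (id : Fin N → Fin N)
  have hmprob : IsProbabilityMeasure m := ⟨by
    rw [← Set.preimage_univ (f := Prod.fst), ← Measure.map_apply measurable_fst .univ, hm1,
      measure_univ]⟩
  have hfst : ∀ {F : Type} [MeasurableSpace F] (f : Fin N → F),
      m.map (fun s => f s.1) = empiricalMeasure f := fun f => by
    have hf : Measurable f := .of_discrete
    calc m.map (fun s => f s.1) = (m.map Prod.fst).map f :=
          (Measure.map_map hf measurable_fst).symm
      _ = empiricalMeasure f := by
          rw [hm1, map_empiricalMeasure hf]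
          rfl
  have hsnd : ∀ {F : Type} [MeasurableSpace F] {f : Ω' → F}, Measurable f →
      m.map (fun s => f s.2) = P'.map f := fun hf => by
    rw [← hm2, Measure.map_map hf measurable_snd]
    rfl
  have hdisc : ∀ {F : Type} [MeasurableSpace F] (f : Fin N → F),
      Measurable fun s : Fin N × Ω' => f s.1 := fun f =>
    (Measurable.of_discrete (f := f)).comp measurable_fst
  have hfin : eLpNorm' (fun s : Fin N × Ω' => edist (X N s.1 ω) (Xbar s.2)) p m ≠ ∞ := by
    refine ne_top_of_le_ne_top (ENNReal.add_ne_top.2 ⟨?_, ?_⟩)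
      (eLpNorm'_edist_le hp (hdisc fun i => X N i ω) (hXbar_meas.comp measurable_snd))
    · rw [← eLpNorm'_map_id (hdisc fun i => X N i ω), hfst fun i => X N i ω]
      exact eLpNorm'_empiricalMeasure_ne_top hN0 hp0 _ measurable_id
    · have hXs : Measurable fun s : Fin N × Ω' => Xbar s.2 := hXbar_meas.comp measurable_snd
      rwa [← eLpNorm'_map_id hXs, hsnd hXbar_meas,
        eLpNorm'_map_id hXbar_meas]
  -- With ω fixed, the particles are functions of the first coordinate and the limit of the second.
  -- Since the first marginal of `m` is uniform, the empirical flow is the law of the particle path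
  -- under `m`, so both are McKean–Vlasov solutions on one space.
  have hW := hstab m μ ν (fun s => ζ s.1 ω) (fun s => ζ' s.2) (fun s => W s.1 ω) (fun s => W' s.2)
    (fun s => R N s.1 ω) (fun s => Rbar s.2) (fun s => X N s.1 ω) (fun s => Xbar s.2)
    (hdisc fun i => ζ i ω) (hζ'm.comp measurable_snd) (hdisc fun i => W i ω)
    (hW'm.comp measurable_snd) (hdisc fun i => R N i ω) (hRbar_meas.comp measurable_snd)
    (hdisc fun i => X N i ω) (hXbar_meas.comp measurable_snd)
    (fun t => by exact (hfst _).trans (hμ t).symm)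
    (fun t => by rw [hν, hsnd (measurable_pairPath_apply hXbar_meas hRbar_meas t)])
    (ae_of_all _ fun s => hμsol s.1)
    (by
      rw [← hm2] at hνsol
      exact ae_of_ae_map measurable_snd.aemeasurable hνsol) hfin
  rw [hfst fun i => pairPath (X N i ω) (R N i ω), hsnd (measurable_pairPath hXbar_meas hRbar_meas)]
    at hW
  refine hW.trans ?_
  have h3 : eLpNorm' (fun s : Fin N × Ω' => edist (ζ s.1 ω) (ζ' s.2) + edist (W s.1 ω) (W' s.2) +
      edist (R N s.1 ω) (Rbar s.2)) p m ≤ 3 * (ε / (ENNReal.ofReal C * 3)) := by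
    refine le_trans ?_ (mul_le_mul_right hm 3)
    rw [← eLpNorm'_const_mul_ennreal hp0 (by norm_num)]
    refine eLpNorm'_mono_enorm_ae hp0.le (ae_of_all _ fun s => ?_)
    rw [enorm_eq_self, enorm_eq_self]
    simp only [Prod.edist_eq]
    set e₁ := edist (ζ s.1 ω) (ζ' s.2)
    set e₂ := edist (W s.1 ω) (W' s.2)
    set e₃ := edist (R N s.1 ω) (Rbar s.2)
    calc e₁ + e₂ + e₃ ≤ max e₁ (max e₂ e₃) + max e₁ (max e₂ e₃) + max e₁ (max e₂ e₃) := by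
          gcongr
          · exact le_max_left _ _
          · exact (le_max_left _ _).trans (le_max_right _ _)
          · exact (le_max_right _ _).trans (le_max_right _ _)
      _ = 3 * max e₁ (max e₂ e₃) := by ring
  calc _ ≤ ENNReal.ofReal C * (3 * (ε / (ENNReal.ofReal C * 3))) := by gcongr
    _ = ENNReal.ofReal C * 3 * (ε / (ENNReal.ofReal C * 3)) := by rw [mul_assoc]
    _ ≤ ε := ENNReal.mul_div_le
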